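/- Let $q$ be a prime power, $z^{[j]}:=z^{q^j}$, let $h=(h_1,\dots,h_n)\in GF(q^N)^n$ be linearly independent over $GF(q)$, and let $\Gamma\subseteq GF(q^N)^n$ be an $[n,k,d]$ maximum rank distance code (dimension $k$, minimum rank distance $d=n-k+1$, where the rank $r(v)$ of a vector $v$ is the maximal number of its coordinates that are linearly independent over $GF(q)$) with parity-check matrix $H=(h_i^{[j]})_{0\le j\le d-2,\;1\le i\le n}$. A codeword $x\in\Gamma$ is sent; the coordinates in a set $T$ of $t$ positions are erased (the receiver knows $T$, but not the values), and an error vector $e$, with $e_i=0$ for $i\in T$, is added on the remaining positions, so that $y_i=x_i+e_i$ is received for $i\notin T$. From $T$ and $(y_i)_{i\notin T}$ the decoder proceeds as follows. **Step 1 (elimination, syndrome).** Start from the $d-1$ equations $$\textstyle(\theta_j):\quad \sum_{i\in T} h_i^{[j]}f_i+\sum_{i\notin T}h_i^{[j]}y_i=\sum_{i\notin T}h_i^{[j]}e_i,\qquad 0\le j\le d-2,$$ in the unknown erased values $f_i$ and errors $e_i$. Eliminate the $f_l$, $l\in T$, one after another, in any order: with $Z$ the coefficient of $f_l$ in the current equation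 number $1$ divided by that in equation number $0$, replace the equation number $j$ by $Z^{[j]}$ times itself minus the equation number $j+1$, for all $j$ for which the latter exists, which leaves one equation less. (When only one equation is left, the step just leaves none.) After all eliminations $D=d-1-t$ equations remain; write them as $s'_j=\sum_{i\notin T}h'^{[j]}_i e_i$, $0\le j<D$, where the $h'_i$ are the coefficients in equation number $0$. Put $S'(z)=\sum_{j<D}s'_jz^{[j]}$. If $S'=0$, conclude $e=0$ and go to Step 5. **Step 2 (Euclid).** Put $F_0=z^{[D]}$, $F_1=S'$ and carry out right divisions $F_{i-1}=Q_i(F_i(z))+F_{i+1}(z)$ of linearized polynomials, $\deg F_{i+1}<\deg F_i$, until $\deg F_k\ge q^{D/2}>\deg F_{k+1}$. Let $m$ be given by $\deg F_k=q^{D-m}$. **Step 3.** Let $j$ be the least index with $s'_j\ne0$, let $\varphi_p$ be the coefficient of $z^{[p]}$ in $F_{k+1}$ for $p<m$ and $\varphi_p=0$ for $p\ge m$, and compute $$\Delta_p=\Big(\varphi_{j+p}-\sum_{i=0}^{p-1}\Delta_i\,s'^{[i]}_{j+p-i}\Big)\Big/s'^{[p]}_j,\qquad p=0,\dots,m,\qquad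 \Delta(z)=\sum_{p=0}^m\Delta_pz^{[p]}.$$ **Step 4.** Choose roots $E_1,\dots,E_m\in GF(q^N)$ of $\Delta$ that are linearly independent over $GF(q)$; solve $s'_p=\sum_{i=1}^mE_i\,x'^{[p]}_i$, $p=0,\dots,m-1$, for $x'_1,\dots,x'_m$; write $x'_p=\sum_{i\notin T}Y_{pi}h'_i$ with $Y_{pi}\in GF(q)$; put $e_i=\sum_pE_pY_{pi}$ for $i\notin T$ and $e_i=0$ for $i\in T$. **Step 5.** Substitute $e$ in the system $(\theta_0),\dots,(\theta_{d-2})$ and solve for $f_i$, $i\in T$. **Step 6.** Fill the erasures of $y$ with the $f_i$ and output $y-e$. **Claim.** Let $2r+s<d$. For every codeword $x$, every set $T$ of $t\le s$ erasures, and every error vector $e$ as above with $r(e)\le r$: every elimination order produces a system of $D=d-1-t$ equations of the form stated in Step 1, in which all coefficients of the erased coordinates are zero and the coefficient of $e_i$ in the equation number $j$ is $h'^{[j]}_i$; the procedure always terminates and, whatever choices it makes, never gets stuck (every division is by a nonzero element, the roots exist and every system to be solved has a solution); and it always outputs the rank $m=r(e)$ (with $m=0$ if $S'=0$), the error vector $e$,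 the erased values $f_i=x_i$ for $i\in T$, and the transmitted codeword $x$. -/

import Mathlib

open Polynomial

noncomputable section

namespace RankDecoding

/-! ### Rank-metric codes

Throughout, `F` plays the role of `GF(q)`, `K` that of `GF(q^N)`, and `z^[j]` means `z ^ (q ^ j)`. -/

/-- The rank `r(x; q)` of `x ∈ K^n`: the maximal number of coordinates of `x` that are linearly
independent over `F`. -/
def rankWt (F : Type*) {K : Type*} [Field F] [Field K] [Algebra F K] {n : ℕ}
    (x : Fin n → K) : ℕ :=
  Set.finrank F (Set.range x)

/-- `Γ` is an `[n, k, d]` maximum rank distance code: `Γ` has dimension `k`, its minimum rank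
distance is `d`, and the Singleton-type bound `d ≤ n - k + 1` is attained. -/
structure IsMRDCode (F : Type*) {K : Type*} [Field F] [Field K] [Algebra F K] {n : ℕ}
    (Γ : Submodule K (Fin n → K)) (k d : ℕ) : Prop where
  dim : Module.finrank K Γ = k
  minDist : IsLeast {w | ∃ x ∈ Γ, ∃ y ∈ Γ, x ≠ y ∧ w = rankWt F (x - y)} d
  singleton_eq : d + k = n + 1

/-- The `(d - 1) × n` matrix whose `j`-th row is `(h₁^[j], …, hₙ^[j])`, `j = 0, …, d - 2`. -/
def mooreMatrix {K : Type*} [Field K] {n : ℕ} (q : ℕ) (h : Fin n → K) (d : ℕ) :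
    Matrix (Fin (d - 1)) (Fin n) K :=
  Matrix.of fun j i => h i ^ q ^ (j : ℕ)

/-- The received word when `x` is sent, the coordinates in `T` are erased (`none`) and the error
vector `e` is added to the other coordinates. -/
def receivedWord {K : Type*} [Field K] {n : ℕ} (x e : Fin n → K) (T : Finset (Fin n)) :
    Fin n → Option K :=
  fun i => if i ∈ T then none else some (x i + e i)

/-- The set of erased positions of a received word. -/
def erasedSet {K : Type*} {n : ℕ} (y : Fin n → Option K) : Finset (Fin n) :=
  Finset.univ.filter fun i => (y i).isNone

/-! ### The linear systems -/

/-- A pair `(a, c)` stands for the equation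
`∑_{i erased} a i * f i + c = ∑_{i not erased} a i * e i`
in the unknown erased values `f` and the unknown errors `e`. -/
abbrev Equation (K : Type*) (n : ℕ) := (Fin n → K) × K

/-- The `d - 1` syndrome equations of a received word, i.e. those expressing that the word with
erasures replaced by the unknowns `f i`, minus the error, is annihilated by the parity checks. -/
def initialSystem {K : Type*} [Field K] {n : ℕ} (q : ℕ) (h : Fin n → K) (d : ℕ)
    (y : Fin n → Option K) : List (Equation K n) :=
  (List.range (d - 1)).map fun j =>
    (fun i => h i ^ q ^ j, ∑ i, (y i).getD 0 * h i ^ q ^ j)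

/-- Coefficient of the `i`-th unknown in the `j`-th equation of a system. -/
def coefAt {K : Type*} [Field K] {n : ℕ} (θ : List (Equation K n)) (j : ℕ) (i : Fin n) : K :=
  (θ.getD j 0).1 i

/-- Elimination of the unknown `f l`: with `Z` the quotient of its coefficients in the equations
number `1` and `0`, equation number `j` is replaced by `Z^[j]` times itself minus equation number
`j + 1`; the new system has one equation less. -/
def eliminate {K : Type*} [Field K] {n : ℕ} (q : ℕ) (l : Fin n) (θ : List (Equation K n)) :
    List (Equation K n) :=
  (List.range (θ.length - 1)).map fun j =>
    (coefAt θ 1 l / coefAt θ 0 l) ^ q ^ j • θ.getD j 0 - θ.getD (j + 1) 0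

/-- The `j`-th syndrome value `s'_j` of a reduced system. -/
def synd {K : Type*} [Field K] {n : ℕ} (θ : List (Equation K n)) (j : ℕ) : K :=
  (θ.getD j 0).2

/-! ### Linearized polynomials -/

/-- `P = ∑ a_j z^[j]`. The product of linearized polynomials is composition, `P * Q = P(Q(z))`. -/
def IsLinearized {K : Type*} [Field K] (q : ℕ) (P : K[X]) : Prop :=
  ∀ i, P.coeff i ≠ 0 → ∃ j, i = q ^ j

/-- The syndrome polynomial `S'(z) = ∑ s'_j z^[j]` of a reduced system. -/
def syndPoly {K : Type*} [Field K] {n : ℕ} (q : ℕ) (θ : List (Equation K n)) : K[X] :=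
  ∑ j ∈ Finset.range θ.length, C (synd θ j) * X ^ q ^ j

/-- The coefficients `Δ_0 = f_j / s_j` and
`Δ_p = (f_{j+p} - ∑_{i<p} Δ_i s_{j+p-i}^[i]) / s_j^[p]`. -/
def locatorCoeff {K : Type*} [Field K] (q : ℕ) (s f : ℕ → K) (j : ℕ) : ℕ → K
  | p => (f (j + p) - ∑ i : Fin p, locatorCoeff q s f j i * s (j + p - i) ^ q ^ (i : ℕ)) /
      s j ^ q ^ p
  decreasing_by exact i.2

/-- The polynomial `Δ(z) = ∑_{p ≤ m} Δ_p z^[p]` obtained from the syndromes, the index `j` of the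
first nonzero one, and the coefficients `f_p` of the remainder `R` for degree `[p]`, with `f_p` set
to `0` for `p ≥ m`. -/
def locatorPoly {K : Type*} [Field K] (q : ℕ) (s : ℕ → K) (R : K[X]) (m j : ℕ) : K[X] :=
  ∑ p ∈ Finset.range (m + 1),
    C (locatorCoeff q s (fun i => if i < m then R.coeff (q ^ i) else 0) j p) * X ^ q ^ p

/-! ### The decoding procedure as a transition system -/

/-- The possible configurations of the decoder. -/
inductive State (K : Type*) [Field K] (n : ℕ)
  /-- current system `θ`; the unknowns `f i`, `i ∈ U`, remain to be eliminated -/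
  | eliminating (θ : List (Equation K n)) (U : Finset (Fin n))
  /-- reduced system and two consecutive remainders of Euclid's algorithm -/
  | dividing (θ : List (Equation K n)) (A B : K[X])
  /-- reduced system, number `m` of rank errors found, polynomial `Δ` -/
  | locating (θ : List (Equation K n)) (m : ℕ) (Δ : K[X])
  /-- the roots `E` have been chosen -/
  | rooted (θ : List (Equation K n)) (m : ℕ) (E : Fin m → K)
  /-- the values `x'` have been computed -/
  | solved (θ : List (Equation K n)) (m : ℕ) (E x' : Fin m → K)
  /-- the error vector `e`, of rank `m`, has been computed -/
  | errorFound (m : ℕ) (e : Fin n → K)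
  /-- final configuration: rank `m` of the error, error `e`, erasure vector `f`, decoded word `x` -/
  | finished (m : ℕ) (e f x : Fin n → K)

/-- Initial configuration of the decoder on input `y`. -/
def start {K : Type*} [Field K] {n : ℕ} (q : ℕ) (h : Fin n → K) (d : ℕ)
    (y : Fin n → Option K) : State K n :=
  .eliminating (initialSystem q h d y) (erasedSet y)

/-- One step of the decoder with parameters `h`, `d` on input `y`. Where the procedure leaves a
choice (order of eliminations, basis of the space of roots), every choice is a possible step. -/
inductive Step (F : Type*) {K : Type*} [Field F] [Fintype F] [Field K] [Algebra F K] {n : ℕ}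
    (h : Fin n → K) (d : ℕ) (y : Fin n → Option K) : State K n → State K n → Prop
  /-- eliminate one more erased coordinate -/
  | elim (θ : List (Equation K n)) (U : Finset (Fin n)) (l : Fin n) (hl : l ∈ U)
      (pivot : coefAt θ 0 l ≠ 0) :
      Step F h d y (.eliminating θ U)
        (.eliminating (eliminate (Fintype.card F) l θ) (U.erase l))
  /-- all syndromes of the reduced system vanish: there is no error -/
  | noError (θ : List (Equation K n)) (hs : ∀ j < θ.length, synd θ j = 0) :
      Step F h d y (.eliminating θ ∅) (.errorFound 0 0)
  /-- otherwise start Euclid's algorithm with `z^[D]` and `S'(z)`, `D` the number of equations -/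
  | euclid (θ : List (Equation K n)) (hs : ∃ j < θ.length, synd θ j ≠ 0) :
      Step F h d y (.eliminating θ ∅)
        (.dividing θ (X ^ Fintype.card F ^ θ.length) (syndPoly (Fintype.card F) θ))
  /-- right division with remainder, as long as the degree is at least `q ^ (D / 2)` -/
  | divide (θ : List (Equation K n)) (A B Q R : K[X])
      (continue_ : (Fintype.card F : ℝ) ^ ((θ.length : ℝ) / 2) ≤ B.natDegree)
      (hQ : IsLinearized (Fintype.card F) Q) (hR : IsLinearized (Fintype.card F) R)
      (division : A = Q.comp B + R) (hdeg : R.degree < B.degree) :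
      Step F h d y (.dividing θ A B) (.dividing θ B R)
  /-- stop Euclid's algorithm; the number `m` of rank errors is read off from the degree
  `q ^ (D - m)` of the last remainder `A` of degree at least `q ^ (D / 2)`, and `Δ` is computed
  from the next remainder `B` -/
  | halt (θ : List (Equation K n)) (A B : K[X]) (m j : ℕ)
      (hA : (Fintype.card F : ℝ) ^ ((θ.length : ℝ) / 2) ≤ A.natDegree)
      (hB : (B.natDegree : ℝ) < (Fintype.card F : ℝ) ^ ((θ.length : ℝ) / 2))
      (hm : m ≤ θ.length) (hmA : A.natDegree = Fintype.card F ^ (θ.length - m))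
      (hj : synd θ j ≠ 0) (hj_min : ∀ i < j, synd θ i = 0) :
      Step F h d y (.dividing θ A B)
        (.locating θ m (locatorPoly (Fintype.card F) (synd θ) B m j))
  /-- find `m` roots of `Δ` that are linearly independent over `F` -/
  | roots (θ : List (Equation K n)) (m : ℕ) (Δ : K[X]) (E : Fin m → K)
      (hE : LinearIndependent F E) (hroot : ∀ p, Δ.IsRoot (E p)) :
      Step F h d y (.locating θ m Δ) (.rooted θ m E)
  /-- solve the truncated system `s'_p = ∑ E_i x'_i^[p]`, `p = 0, …, m - 1` -/
  | solve (θ : List (Equation K n)) (m : ℕ) (E x' : Fin m → K)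
      (hx' : ∀ p < m, synd θ p = ∑ i, E i * x' i ^ Fintype.card F ^ p) :
      Step F h d y (.rooted θ m E) (.solved θ m E x')
  /-- write `x'_p = ∑_i Y_{pi} h'_i` over the non-erased positions, `Y` with entries in `F` and
  `h'` the coefficients of equation number `0` of the reduced system, and put `e = E Y` -/
  | error (θ : List (Equation K n)) (m : ℕ) (E x' : Fin m → K) (Y : Matrix (Fin m) (Fin n) F)
      (hY_erased : ∀ p, ∀ i ∈ erasedSet y, Y p i = 0)
      (hY : ∀ p, x' p = ∑ i, Y p i • coefAt θ 0 i) :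
      Step F h d y (.solved θ m E x') (.errorFound m fun i => ∑ p, Y p i • E p)
  /-- substitute `e` in the initial system, solve for the erased values `f`, and subtract `e` from
  the received word with its erasures filled in by `f` -/
  | finish (m : ℕ) (e f : Fin n → K) (hf_supp : ∀ i ∉ erasedSet y, f i = 0)
      (hf : ∀ eq ∈ initialSystem (Fintype.card F) h d y,
        ∑ i ∈ erasedSet y, eq.1 i * f i + eq.2 = ∑ i ∈ (erasedSet y)ᶜ, eq.1 i * e i) :
      Step F h d y (.errorFound m e) (.finished m e f fun i => (y i).getD (f i) - e i)

/-- A configuration that some execution of the decoder on input `y` passes through. -/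
def Reachable (F : Type*) {K : Type*} [Field F] [Fintype F] [Field K] [Algebra F K] {n : ℕ}
    (h : Fin n → K) (d : ℕ) (y : Fin n → Option K) (σ : State K n) : Prop :=
  Relation.ReflTransGen (Step F h d y) (start (Fintype.card F) h d y) σ

end RankDecoding

end

/-! Everything rests on Moore matrices: if `x_1, …, x_ρ` are independent over `F`, then any `ρ`
consecutive rows `(x_u^[l])_u` have trivial kernel (`eq_zero_of_moore`). Elimination respects this
structure. Combining equations `j` and `j + 1` replaces each coefficient `a_i^[j]` by `(Z a_i -
a_i^q)^[j]`, and `z ↦ Z z - z^q` is `F`-linear with kernel the line through the pivot; so the Moore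
shape persists and the surviving coefficients stay independent. The sent word satisfies every
derived check, so the reduced syndromes depend on `e` alone.

Write `e = E Y` with `E` a basis of the span of the coordinates of `e`, and `ρ = r(e)`. Then `s'_j =
∑ E_u x_u^[j]` with `x = Y h'` independent (`exists_decomposition`). For a linearized `U` of degree
at most `q^l`, `l < D`, the coefficient of `z^[l]` in `U(S'(z))` is `∑ U(E_u) x_u^[l]`
(`SyndromeDecomposition.coeff_comp`). Euclid's algorithm keeps each remainder congruent to
`U(S'(z))` modulo `z^[D]`, and keeps constant the product of the degrees of a cofactor and of the
preceding remainder. At the halt the last remainder has no terms in the upper half, which gives `ρ`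
Moore equations for the values `U(E_u)`; so the cofactor vanishes on `E`, and comparing degrees
gives `m = ρ` (`EuclidPair.halt`).

The root space of this cofactor is therefore exactly the error span, and the recursion for `Δ`
recovers the cofactor by inverting a twisted convolution (`locatorPoly_eq`). Afterwards any
independent roots form a basis of the span, and `x'`, `Y` and the erased values are uniquely
determined.

The claims about executions come from one `Invariant`: every step preserves it, and it guarantees a
next step until the end. Termination is the descent of a lexicographic measure. -/

noncomputable section

namespace RankDecoding

/-! ### Frobenius powers and the nonsingularity of Moore matrices. -/

section Frobenius

variable (F : Type*) [Field F] [Fintype F]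

/-- The `F`-linear map `z ↦ z ^ (q ^ j)`, `q` the cardinality of `F`. -/
def frobPow (A : Type*) [CommRing A] [Algebra F A] (j : ℕ) : A →ₐ[F] A :=
  FiniteField.frobeniusAlgHom F A ^ j

theorem frobPow_apply {A : Type*} [CommRing A] [Algebra F A] (j : ℕ) (z : A) :
    frobPow F A j z = z ^ Fintype.card F ^ j := by
  induction j generalizing z with
  | zero => simp [frobPow]
  | succ j ih =>
    have : frobPow F A (j + 1) z = frobPow F A j (FiniteField.frobeniusAlgHom F A z) := by
      simp [frobPow, pow_succ]
    rw [this, ih]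
    simp [pow_succ', pow_mul]

variable {A : Type*} [CommRing A] [Algebra F A]

theorem add_pow_card_pow (j : ℕ) (a b : A) :
    (a + b) ^ Fintype.card F ^ j = a ^ Fintype.card F ^ j + b ^ Fintype.card F ^ j := by
  simp only [← frobPow_apply, map_add]

theorem sub_pow_card_pow (j : ℕ) (a b : A) :
    (a - b) ^ Fintype.card F ^ j = a ^ Fintype.card F ^ j - b ^ Fintype.card F ^ j := by
  simp only [← frobPow_apply, map_sub]

theorem smul_pow_card_pow (j : ℕ) (c : F) (a : A) :
    (c • a) ^ Fintype.card F ^ j = c • a ^ Fintype.card F ^ j := by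
  simp only [← frobPow_apply, map_smul]

theorem sum_pow_card_pow (j : ℕ) {ι : Type*} (s : Finset ι) (f : ι → A) :
    (∑ i ∈ s, f i) ^ Fintype.card F ^ j = ∑ i ∈ s, f i ^ Fintype.card F ^ j := by
  simp only [← frobPow_apply, map_sum]

variable {F} {K : Type*} [Field K] [Algebra F K]

/-- `X^q - X` already splits over `F` into the factors `X - a`, so evaluating it at `z` makes one of
these factors vanish. -/
theorem mem_range_algebraMap_of_pow_card {z : K} (hz : z ^ Fintype.card F = z) :
    ∃ c : F, algebraMap F K c = z := by
  have h1 : (X ^ Fintype.card F - X : F[X]) = ∏ a : F, (X - C a) := by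
    have h := FiniteField.roots_X_pow_card_sub_X F
    have hm : (X ^ Fintype.card F - X : F[X]).Monic := by
      apply monic_X_pow_sub
      simpa [degree_X] using Fintype.one_lt_card (α := F)
    have h2 := prod_multiset_X_sub_C_of_monic_of_roots_card_eq hm (by
      rw [h, FiniteField.X_pow_card_sub_X_natDegree_eq _ Fintype.one_lt_card]; rfl)
    rw [← h2, h]; rfl
  have h3 := congrArg (aeval z) h1
  simp only [map_sub, map_pow, aeval_X, hz, sub_self, map_prod, aeval_C] at h3
  obtain ⟨c, -, hc⟩ := Finset.prod_eq_zero_iff.1 h3.symm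
  exact ⟨c, (sub_eq_zero.1 hc).symm⟩

/-- The map `z ↦ (a ^ q / a) * z - z ^ q` that kills `a`. -/
def elimMap (F : Type*) [Field F] [Fintype F] [Algebra F K] (a : K) : K →ₗ[F] K :=
  LinearMap.mulLeft F (a ^ Fintype.card F / a) - (frobPow F K 1).toLinearMap

theorem elimMap_apply (a z : K) :
    elimMap F a z = a ^ Fintype.card F / a * z - z ^ Fintype.card F := by
  simp [elimMap, frobPow_apply]

theorem elimMap_self {a : K} (ha : a ≠ 0) : elimMap F a a = 0 := by
  rw [elimMap_apply, div_mul_cancel₀ _ ha, sub_self]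

theorem mem_span_of_elimMap_eq_zero {a z : K} (ha : a ≠ 0) (hz : elimMap F a z = 0) :
    ∃ c : F, z = c • a := by
  rw [elimMap_apply, sub_eq_zero] at hz
  obtain ⟨c, hc⟩ := mem_range_algebraMap_of_pow_card (F := F) (z := z / a) (by
    rw [div_pow, ← hz]
    have := pow_ne_zero (Fintype.card F) ha
    field_simp)
  exact ⟨c, by rw [Algebra.smul_def, hc, div_mul_cancel₀ _ ha]⟩

variable {ι : Type*}

/-- The kernel of the map is the line through `x v`, which meets the span of the other `x u` only in
zero. -/
theorem LinearIndepOn.elimMap {x : ι → K} {s : Set ι} {v : ι} (hv : v ∉ s)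
    (hx : LinearIndepOn F x (insert v s)) : LinearIndepOn F (fun u => elimMap F (x v) (x u)) s := by
  have hxv : x v ≠ 0 := hx.ne_zero (Set.mem_insert _ _)
  obtain ⟨hs, hvs⟩ := (linearIndepOn_insert hv).1 hx
  refine (LinearIndependent.map hs ?_ : LinearIndependent F (RankDecoding.elimMap F (x v) ∘ _))
  rw [Submodule.disjoint_def]
  intro z hz hz0
  obtain ⟨c, rfl⟩ := mem_span_of_elimMap_eq_zero hxv (LinearMap.mem_ker.1 hz0)
  by_cases hc : c = 0
  · simp [hc]
  · refine absurd ?_ hvs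
    have := Submodule.smul_mem _ c⁻¹ hz
    rw [inv_smul_smul₀ hc] at this
    rwa [Set.image_eq_range]

/-- Induction on the number of columns: the elimination step applied to rows `l` and `l + 1` yields
a Moore system with one column and one row less. -/
theorem eq_zero_of_moore_finset {x : ι → K} (s : Finset ι) (hx : LinearIndepOn F x (s : Set ι))
    (c : ι → K) (hc : ∀ l < s.card, ∑ u ∈ s, c u * x u ^ Fintype.card F ^ l = 0) :
    ∀ u ∈ s, c u = 0 := by
  classical
  induction s using Finset.induction_on generalizing x with
  | empty => simp
  | insert v s hv ih =>
    rw [Finset.coe_insert] at hx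
    have hxv : x v ≠ 0 := hx.ne_zero (Set.mem_insert _ _)
    rw [Finset.card_insert_of_notMem hv] at hc
    have h0 : ∀ u ∈ s, c u = 0 := by
      refine ih (LinearIndepOn.elimMap (by simpa using hv) hx) fun l hl => ?_
      have e1 := hc l (by omega)
      have e2 := hc (l + 1) (by omega)
      -- The added zero becomes the term of `v`, which the map kills; the sum then runs over all
      -- columns and splits into two of the given rows.
      rw [← add_zero (∑ u ∈ s, _)]
      calc _ = ∑ u ∈ insert v s, c u * (RankDecoding.elimMap F (x v) (x u)) ^ Fintype.card F ^ l := by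
            rw [Finset.sum_insert hv, elimMap_self hxv, zero_pow (by positivity), mul_zero,
              add_comm]
        _ = (x v ^ Fintype.card F / x v) ^ Fintype.card F ^ l *
              ∑ u ∈ insert v s, c u * x u ^ Fintype.card F ^ l -
              ∑ u ∈ insert v s, c u * x u ^ Fintype.card F ^ (l + 1) := by
            rw [Finset.mul_sum, ← Finset.sum_sub_distrib]
            refine Finset.sum_congr rfl fun u _ => ?_
            rw [elimMap_apply, sub_pow_card_pow, mul_pow, ← pow_mul, ← pow_succ']
            ring
        _ = 0 := by rw [e1, e2]; simp
    intro u hu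
    rcases Finset.mem_insert.1 hu with rfl | hu
    · have e1 := hc 0 (by omega)
      rw [Finset.sum_insert hv, Finset.sum_eq_zero fun w hw => by rw [h0 w hw, zero_mul]] at e1
      simpa [hxv] using e1
    · exact h0 u hu

theorem LinearIndependent.frobPow {x : ι → K} (hx : LinearIndependent F x) (j : ℕ) :
    LinearIndependent F fun u => x u ^ Fintype.card F ^ j := by
  have := hx.map' (RankDecoding.frobPow F K j).toLinearMap
    (LinearMap.ker_eq_bot.2 (RankDecoding.frobPow F K j).toRingHom.injective)
  simpa [Function.comp_def, frobPow_apply] using! this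

/-- Consecutive rows of a Moore matrix with independent generators have trivial kernel. -/
theorem eq_zero_of_moore [Fintype ι] {x : ι → K} (hx : LinearIndependent F x) (c : ι → K) (l₀ : ℕ)
    (hc : ∀ l < Fintype.card ι, ∑ u, c u * x u ^ Fintype.card F ^ (l₀ + l) = 0) : c = 0 := by
  funext u
  refine eq_zero_of_moore_finset (F := F) (x := fun u => x u ^ Fintype.card F ^ l₀) Finset.univ
    ?_ c ?_ u (Finset.mem_univ u)
  · simpa [linearIndepOn_univ_iff] using LinearIndependent.frobPow hx l₀
  · intro l hl
    simpa only [← pow_mul, ← pow_add] using hc l hl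

end Frobenius

/-! ### Linearized polynomials: composition, right division, root spaces. -/

section Linearized

variable {F : Type*} [Field F] [Fintype F] {K : Type*} [Field K]

local notation "q" => Fintype.card F

theorem card_pow_pos (j : ℕ) : 0 < q ^ j := pow_pos Fintype.card_pos j

theorem card_pow_injective : Function.Injective fun j : ℕ => q ^ j :=
  Nat.pow_right_injective Fintype.one_lt_card

theorem IsLinearized.zero {p : ℕ} : IsLinearized p (0 : K[X]) := fun i hi => absurd (coeff_zero i) hi

theorem IsLinearized.monomial {p : ℕ} (c : K) (j : ℕ) : IsLinearized p (C c * X ^ p ^ j) := by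
  intro i hi
  rw [coeff_C_mul_X_pow] at hi
  exact ⟨j, by by_contra h; simp [h] at hi⟩

theorem IsLinearized.add {p : ℕ} {P Q : K[X]} (hP : IsLinearized p P) (hQ : IsLinearized p Q) :
    IsLinearized p (P + Q) := by
  intro i hi
  by_cases h : P.coeff i = 0
  · exact hQ i (by simpa [h] using hi)
  · exact hP i h

theorem IsLinearized.neg {p : ℕ} {P : K[X]} (hP : IsLinearized p P) : IsLinearized p (-P) :=
  fun i hi => hP i (by simpa using hi)

theorem IsLinearized.sub {p : ℕ} {P Q : K[X]} (hP : IsLinearized p P) (hQ : IsLinearized p Q) :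
    IsLinearized p (P - Q) := by
  rw [sub_eq_add_neg]
  exact hP.add hQ.neg

theorem IsLinearized.sum {p : ℕ} {ι : Type*} (s : Finset ι) (f : ι → K[X])
    (hf : ∀ i ∈ s, IsLinearized p (f i)) : IsLinearized p (∑ i ∈ s, f i) := by
  classical
  induction s using Finset.induction_on with
  | empty => simpa using IsLinearized.zero
  | insert a s ha ih =>
    rw [Finset.sum_insert ha]
    exact (hf a (by simp)).add (ih fun i hi => hf i (by simp [hi]))

theorem IsLinearized.X {p : ℕ} : IsLinearized p (X : K[X]) := by
  simpa using IsLinearized.monomial (p := p) (1 : K) 0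

theorem IsLinearized.coeff_zero {P : K[X]} (hP : IsLinearized q P) : P.coeff 0 = 0 := by
  by_contra h
  obtain ⟨j, hj⟩ := hP 0 h
  exact (card_pow_pos (F := F) j).ne hj

theorem IsLinearized.natDegree_eq {p : ℕ} {P : K[X]} (hP : IsLinearized p P) (h0 : P ≠ 0) :
    ∃ j, P.natDegree = p ^ j :=
  hP _ (by simpa using h0)

theorem IsLinearized.natDegree_pos {P : K[X]} (hP : IsLinearized q P) (h0 : P ≠ 0) :
    0 < P.natDegree := by
  obtain ⟨j, hj⟩ := hP.natDegree_eq h0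
  rw [hj]
  exact card_pow_pos j

theorem coeff_sum_linearized (s : Finset ℕ) (c : ℕ → K) (l : ℕ) :
    (∑ j ∈ s, C (c j) * X ^ q ^ j).coeff (q ^ l) = if l ∈ s then c l else 0 := by
  rw [finsetSum_coeff, ← Finset.sum_ite_eq s l c]
  refine Finset.sum_congr rfl fun j _ => ?_
  rw [coeff_C_mul_X_pow]
  simp only [(card_pow_injective (F := F)).eq_iff]

theorem IsLinearized.ext {p : ℕ} {P Q : K[X]} (hP : IsLinearized p P) (hQ : IsLinearized p Q)
    (h : ∀ l, P.coeff (p ^ l) = Q.coeff (p ^ l)) : P = Q := by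
  ext i
  by_cases hi : ∃ j, i = p ^ j
  · obtain ⟨j, rfl⟩ := hi
    exact h j
  · rw [not_imp_comm.1 (hP i) hi, not_imp_comm.1 (hQ i) hi]

theorem IsLinearized.eq_sum {P : K[X]} (hP : IsLinearized q P) {m : ℕ}
    (hm : P.natDegree < q ^ m) :
    P = ∑ i ∈ Finset.range m, C (P.coeff (q ^ i)) * Polynomial.X ^ q ^ i := by
  refine hP.ext (.sum _ _ fun i _ => .monomial _ _) fun l => ?_
  rw [coeff_sum_linearized]
  split_ifs with h
  · rfl
  · refine coeff_eq_zero_of_natDegree_lt (hm.trans_le ?_)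
    exact Nat.pow_le_pow_right Fintype.card_pos (by simpa using h)

/-- A crude bound that lets any linearized polynomial be expanded when its exact degree is
irrelevant. -/
theorem natDegree_lt_card_pow (P : K[X]) : P.natDegree < q ^ P.natDegree :=
  Nat.lt_pow_self Fintype.one_lt_card

theorem IsLinearized.comp_eq_sum {P : K[X]} (hP : IsLinearized q P) {m : ℕ}
    (hm : P.natDegree < q ^ m) (Q : K[X]) :
    P.comp Q = ∑ i ∈ Finset.range m, C (P.coeff (q ^ i)) * Q ^ q ^ i := by
  conv_lhs => rw [hP.eq_sum hm]
  simp

theorem IsLinearized.eval_eq_sum {P : K[X]} (hP : IsLinearized q P) {m : ℕ}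
    (hm : P.natDegree < q ^ m) (z : K) :
    P.eval z = ∑ i ∈ Finset.range m, P.coeff (q ^ i) * z ^ q ^ i := by
  conv_lhs => rw [hP.eq_sum hm]
  simp [eval_finsetSum]

theorem IsLinearized.dvd_comp {P : K[X]} (hP : IsLinearized q P) (A : K[X]) : A ∣ P.comp A := by
  obtain ⟨R, hR⟩ := X_dvd_iff.2 hP.coeff_zero
  rw [hR, mul_comp, X_comp]
  exact dvd_mul_right _ _

variable [Algebra F K]

theorem IsLinearized.pow_card_pow {Q : K[X]} (hQ : IsLinearized q Q) (i : ℕ) :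
    IsLinearized q (Q ^ q ^ i) := by
  rw [hQ.eq_sum (natDegree_lt_card_pow (F := F) Q), sum_pow_card_pow]
  refine .sum _ _ fun j _ => ?_
  rw [mul_pow, ← C_pow, ← pow_mul, ← pow_add]
  exact .monomial _ _

theorem IsLinearized.comp {P Q : K[X]} (hP : IsLinearized q P) (hQ : IsLinearized q Q) :
    IsLinearized q (P.comp Q) := by
  rw [hP.comp_eq_sum (natDegree_lt_card_pow (F := F) P)]
  refine .sum _ _ fun i _ => ?_
  intro n hn
  rw [coeff_C_mul] at hn
  exact hQ.pow_card_pow i n (right_ne_zero_of_mul hn)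

theorem IsLinearized.comp_sub {P : K[X]} (hP : IsLinearized q P) (A B : K[X]) :
    P.comp (A - B) = P.comp A - P.comp B := by
  simp only [hP.comp_eq_sum (natDegree_lt_card_pow (F := F) P), sub_pow_card_pow, mul_sub,
    Finset.sum_sub_distrib]

/-- Right division with remainder of linearized polynomials. -/
theorem IsLinearized.exists_right_division {B : K[X]} (hB : IsLinearized q B) (hB0 : B ≠ 0)
    {A : K[X]} (hA : IsLinearized q A) :
    ∃ Q R : K[X], IsLinearized q Q ∧ IsLinearized q R ∧ A = Q.comp B + R ∧
      R.degree < B.degree := by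
  induction hd : A.degree using WellFoundedLT.induction generalizing A with
  | ind a ih =>
    subst hd
    by_cases hlt : A.degree < B.degree
    · exact ⟨0, A, .zero, hA, by simp, hlt⟩
    have hA0 : A ≠ 0 := by
      rintro rfl
      exact hlt (by simpa [bot_lt_iff_ne_bot] using hB0)
    obtain ⟨i, hi⟩ := hA.natDegree_eq hA0
    obtain ⟨j, hj⟩ := hB.natDegree_eq hB0
    have hle : B.natDegree ≤ A.natDegree := natDegree_le_natDegree (not_lt.1 hlt)
    have hji : j ≤ i := by
      rw [hi, hj] at hle
      exact (Nat.pow_le_pow_iff_right Fintype.one_lt_card).1 hle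
    set M : K[X] := C (A.leadingCoeff / B.leadingCoeff ^ q ^ (i - j)) * Polynomial.X ^ q ^ (i - j)
    have hM : IsLinearized q M := .monomial _ _
    have hlc : A.leadingCoeff / B.leadingCoeff ^ q ^ (i - j) ≠ 0 :=
      div_ne_zero (by simpa using hA0) (pow_ne_zero _ (by simpa using hB0))
    have hMB : M.comp B = C (A.leadingCoeff / B.leadingCoeff ^ q ^ (i - j)) * B ^ q ^ (i - j) := by
      simp [M]
    have hdeg : (M.comp B).natDegree = A.natDegree := by
      rw [hMB, natDegree_C_mul hlc, natDegree_pow, hi, hj, ← pow_add, Nat.sub_add_cancel hji]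
    have hlead : (M.comp B).leadingCoeff = A.leadingCoeff := by
      rw [hMB, leadingCoeff_mul, leadingCoeff_C, leadingCoeff_pow,
        div_mul_cancel₀ _ (pow_ne_zero _ (by simpa using hB0))]
    have hMB0 : M.comp B ≠ 0 := by
      rw [← leadingCoeff_ne_zero, hlead]
      simpa using hA0
    have hsub : (A - M.comp B).degree < A.degree :=
      degree_sub_lt_left (by rw [degree_eq_natDegree hA0, degree_eq_natDegree hMB0, hdeg]) hA0
        hlead.symm
    obtain ⟨Q, R, hQ, hR, h, hRB⟩ := ih _ hsub (hA.sub (hM.comp hB)) rfl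
    refine ⟨M + Q, R, hM.add hQ, hR, ?_, hRB⟩
    rw [add_comp, add_assoc, ← h]
    ring

/-- Composition is a convolution twisted by Frobenius. For `l < D` the truncation of the inner sum
is invisible; the condition `i ≤ l` guards the natural subtraction. -/
theorem coeff_comp_linearized {P : K[X]} (hP : IsLinearized q P) {m : ℕ}
    (hm : P.natDegree < q ^ m) (s : ℕ → K) (D l : ℕ) (hl : l < D) :
    (P.comp (∑ j ∈ Finset.range D, C (s j) * X ^ q ^ j)).coeff (q ^ l) =
      ∑ i ∈ Finset.range m, if i ≤ l then P.coeff (q ^ i) * s (l - i) ^ q ^ i else 0 := by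
  rw [hP.comp_eq_sum hm, finsetSum_coeff]
  refine Finset.sum_congr rfl fun i _ => ?_
  rw [coeff_C_mul, sum_pow_card_pow, finsetSum_coeff]
  simp only [mul_pow, ← C_pow, ← pow_mul, ← pow_add, coeff_C_mul_X_pow,
    (card_pow_injective (F := F)).eq_iff]
  split_ifs with h
  · rw [Finset.sum_eq_single (l - i)]
    · rw [if_pos (by omega)]
    · intro j _ hj
      rw [if_neg (by omega)]
    · intro hj
      exact absurd (Finset.mem_range.2 (by omega)) hj
  · rw [Finset.sum_eq_zero, mul_zero]
    intro j _
    rw [if_neg (by omega)]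

/-- The roots of a linearized polynomial. -/
def rootSpace (P : K[X]) (hP : IsLinearized q P) : Submodule F K where
  carrier := {z | P.eval z = 0}
  zero_mem' := by
    simp [hP.eval_eq_sum (natDegree_lt_card_pow (F := F) P)]
  add_mem' {a b} ha hb := by
    simp only [Set.mem_ofPred_eq, hP.eval_eq_sum (natDegree_lt_card_pow (F := F) P),
      add_pow_card_pow, mul_add, Finset.sum_add_distrib] at ha hb ⊢
    rw [ha, hb, add_zero]
  smul_mem' c a ha := by
    simp only [Set.mem_ofPred_eq, hP.eval_eq_sum (natDegree_lt_card_pow (F := F) P),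
      smul_pow_card_pow, mul_smul_comm, ← Finset.smul_sum] at ha ⊢
    rw [ha, smul_zero]

theorem mem_rootSpace {P : K[X]} {hP : IsLinearized q P} {z : K} :
    z ∈ rootSpace P hP ↔ P.eval z = 0 := Iff.rfl

/-- An `F`-space of dimension `δ` has `q^δ` elements, and a polynomial of degree `q^m` has at most
`q^m` roots. -/
theorem finrank_rootSpace_le [Finite K] {P : K[X]} (hP : IsLinearized q P) {m : ℕ}
    (hm : P.natDegree = q ^ m) : Module.finrank F (rootSpace P hP) ≤ m := by
  have hP0 : P ≠ 0 := by
    rintro rfl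
    exact (card_pow_pos (F := F) m).ne hm
  have h1 : Nat.card (rootSpace P hP) ≤ q ^ m := by
    classical
    rw [← hm]
    have : (rootSpace P hP : Set K) ⊆ P.roots.toFinset := by
      intro z hz
      simpa [hP0] using mem_rootSpace.1 hz
    calc Nat.card (rootSpace P hP) = (rootSpace P hP : Set K).ncard := rfl
      _ ≤ (P.roots.toFinset : Set K).ncard := Set.ncard_le_ncard this
      _ ≤ P.natDegree := by
        rw [Set.ncard_coe_finset]
        exact (Multiset.toFinset_card_le _).trans (card_roots' P)
  rw [Module.natCard_eq_pow_finrank (K := F), Nat.card_eq_fintype_card] at h1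
  exact (Nat.pow_le_pow_iff_right Fintype.one_lt_card).1 h1

end Linearized

/-! ### Euclid's algorithm and the error span polynomial. -/

section Euclid

variable {F : Type*} [Field F] [Fintype F] {K : Type*} [Field K]

local notation "q" => Fintype.card F

theorem rpow_half_le_iff (D a : ℕ) :
    (q : ℝ) ^ ((D : ℝ) / 2) ≤ ((q ^ a : ℕ) : ℝ) ↔ D ≤ 2 * a := by
  have hq : (1 : ℝ) < q := by exact_mod_cast Fintype.one_lt_card (α := F)
  rw [Nat.cast_pow, ← Real.rpow_natCast, Real.rpow_le_rpow_left_iff hq,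
    div_le_iff₀ (by norm_num)]
  norm_cast
  rw [mul_comm]

/-- Two consecutive remainders `A`, `B` of Euclid's algorithm started with `z^[D]` and `S`, with the
cofactors `UA`, `UB` of `S` in them. -/
structure EuclidPair (p D : ℕ) (S A B UA UB : K[X]) : Prop where
  linA : IsLinearized p A
  linB : IsLinearized p B
  linUA : IsLinearized p UA
  linUB : IsLinearized p UB
  degree_lt : B.degree < A.degree
  half : ∃ a, A.natDegree = p ^ a ∧ D ≤ 2 * a
  natDegree_mul : UB.natDegree * A.natDegree = p ^ D
  cofactor_degree_lt : UA.degree < UB.degree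
  dvdA : X ^ p ^ D ∣ A - UA.comp S
  dvdB : X ^ p ^ D ∣ B - UB.comp S

theorem EuclidPair.start {p D : ℕ} {S : K[X]} (hS : IsLinearized p S) (hdeg : S.degree < (p ^ D : ℕ)) :
    EuclidPair p D S (X ^ p ^ D) S 0 X where
  linA := by simpa using IsLinearized.monomial (p := p) (1 : K) D
  linB := hS
  linUA := .zero
  linUB := .X
  degree_lt := by rwa [degree_X_pow]
  half := ⟨D, natDegree_X_pow _, by omega⟩
  natDegree_mul := by simp
  cofactor_degree_lt := by simp
  dvdA := by simp
  dvdB := by simp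

theorem coeff_eq_of_dvd_sub {D : ℕ} {A U S : K[X]} (h : X ^ q ^ D ∣ A - U.comp S) {l : ℕ} (hl : l < D) :
    A.coeff (q ^ l) = (U.comp S).coeff (q ^ l) := by
  have := X_pow_dvd_iff.1 h (q ^ l) (Nat.pow_lt_pow_right Fintype.one_lt_card hl)
  rwa [coeff_sub, sub_eq_zero] at this

variable [Algebra F K]

/-- The cofactors obey the same recursion as the remainders. Degrees multiply under composition:
dividing takes a factor `deg Q` from the remainder and gives it to the cofactor. -/
theorem EuclidPair.divide {D : ℕ} {S A B UA UB Q R : K[X]} (H : EuclidPair q D S A B UA UB)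
    (hB : ∃ b, B.natDegree = q ^ b ∧ D ≤ 2 * b)
    (hQ : IsLinearized q Q) (hR : IsLinearized q R) (h : A = Q.comp B + R)
    (hdeg : R.degree < B.degree) : EuclidPair q D S B R UB (UA - Q.comp UB) := by
  have hBA : B.natDegree < A.natDegree := by
    obtain ⟨b, hb, -⟩ := hB
    refine natDegree_lt_natDegree ?_ H.degree_lt
    rintro rfl
    exact (card_pow_pos (F := F) b).ne hb
  have hQB : Q.natDegree * B.natDegree = A.natDegree := by
    by_cases h0 : Q.comp B = 0
    · rw [h0, zero_add] at h
      exact absurd (h ▸ hdeg) H.degree_lt.asymm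
    rw [← natDegree_comp]
    refine natDegree_eq_of_degree_eq ?_
    rw [h, degree_add_eq_left_of_degree_lt]
    refine hdeg.trans_le ?_
    exact degree_le_of_dvd (hQ.dvd_comp B) h0
  -- Since `B` has smaller degree than `A`, the quotient is not of degree one, so the cofactor
  -- degree strictly increases.
  have hQ1 : 1 < Q.natDegree := by
    by_contra hlt
    have : Q.natDegree * B.natDegree ≤ 1 * B.natDegree := Nat.mul_le_mul_right _ (not_lt.1 hlt)
    omega
  have hUB0 : UB ≠ 0 := by
    rintro rfl
    simpa using H.cofactor_degree_lt
  have hUBQ : UB.natDegree < (Q.comp UB).natDegree := by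
    rw [natDegree_comp]
    have := H.linUB.natDegree_pos hUB0
    nlinarith
  have hlt : UB.degree < (Q.comp UB).degree := degree_lt_degree hUBQ
  have hlt' : UA.degree < (Q.comp UB).degree := H.cofactor_degree_lt.trans hlt
  have hdegU : (UA - Q.comp UB).degree = (Q.comp UB).degree := by
    rw [degree_sub_eq_right_of_degree_lt hlt']
  refine ⟨H.linB, hR, H.linUB, H.linUA.sub (hQ.comp H.linUB), hdeg, hB, ?_, ?_, H.dvdB, ?_⟩
  · rw [natDegree_eq_of_degree_eq hdegU, natDegree_comp, ← H.natDegree_mul, ← hQB]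
    ring
  · rwa [hdegU]
  -- Additivity of `Q` writes the new congruence as a combination of the two old ones; composing
  -- with `Q` on the left preserves divisibility because `Q` has no constant term.
  · have e : R - (UA - Q.comp UB).comp S = (A - UA.comp S) - Q.comp (B - UB.comp S) := by
      rw [hQ.comp_sub, sub_comp, comp_assoc, h]
      ring
    rw [e]
    exact dvd_sub H.dvdA (H.dvdB.trans (hQ.dvd_comp _))

/-- The syndromes `s j`, `j < D`, have the form `∑ E_u x_u^[j]` with independent `E` and `x`. -/
structure SyndromeDecomposition (F : Type*) {K : Type*} [Field F] [Fintype F] [Field K]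
    [Algebra F K] {ρ : ℕ} (D : ℕ) (s : ℕ → K) (E x : Fin ρ → K) : Prop where
  two_mul_le : 2 * ρ ≤ D
  indepE : LinearIndependent F E
  indepX : LinearIndependent F x
  synd_eq : ∀ j < D, s j = ∑ u, E u * x u ^ Fintype.card F ^ j

variable {ρ D : ℕ} {s : ℕ → K} {E x : Fin ρ → K}

/-- The first `ρ` syndromes vanish only if there are no errors. -/
theorem SyndromeDecomposition.exists_ne_zero (H : SyndromeDecomposition F D s E x) (hρ : 0 < ρ) :
    ∃ j < ρ, s j ≠ 0 := by
  by_contra! hcon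
  have h0 : E = 0 := eq_zero_of_moore H.indepX E 0 fun l hl => by
    rw [Fintype.card_fin] at hl
    rw [zero_add, ← H.synd_eq l (by have := H.two_mul_le; omega), hcon l hl]
  exact H.indepE.ne_zero ⟨0, hρ⟩ (congrFun h0 _)

/-- The bound `m ≤ l + 1` ensures that no term of the convolution is cut off, so each syndrome can
be replaced by its decomposition and the powers of `E u` reassemble to `U (E u)`. -/
theorem SyndromeDecomposition.coeff_comp (H : SyndromeDecomposition F D s E x) {U : K[X]}
    (hU : IsLinearized q U) {m l : ℕ} (hm : U.natDegree < q ^ m) (hml : m ≤ l + 1) (hl : l < D) :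
    (U.comp (∑ j ∈ Finset.range D, C (s j) * X ^ q ^ j)).coeff (q ^ l) =
      ∑ u, U.eval (E u) * x u ^ q ^ l := by
  rw [coeff_comp_linearized hU hm s D l hl]
  simp only [hU.eval_eq_sum hm, Finset.sum_mul]
  rw [Finset.sum_comm]
  refine Finset.sum_congr rfl fun i hi => ?_
  rw [Finset.mem_range] at hi
  rw [if_pos (by omega), H.synd_eq _ (by omega), sum_pow_card_pow, Finset.mul_sum]
  refine Finset.sum_congr rfl fun u _ => ?_
  rw [mul_pow, ← pow_mul, ← pow_add, Nat.sub_add_cancel (by omega), mul_assoc]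

/-- When Euclid's algorithm stops, the cofactor of the remainder is an error span polynomial. -/
theorem EuclidPair.halt [Finite K] (H : SyndromeDecomposition F D s E x) {A B UA UB : K[X]}
    (HE : EuclidPair q D (∑ j ∈ Finset.range D, C (s j) * X ^ q ^ j) A B UA UB)
    (hB : ∀ l, D ≤ 2 * l → B.natDegree < q ^ l) {m : ℕ} (hm : m ≤ D)
    (hmA : A.natDegree = q ^ (D - m)) :
    m = ρ ∧ UB.natDegree = q ^ m ∧ ∀ u, UB.eval (E u) = 0 := by
  have h2ρ := H.two_mul_le
  have hUB : UB.natDegree = q ^ m := by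
    have h1 := HE.natDegree_mul
    rw [hmA] at h1
    refine Nat.eq_of_mul_eq_mul_right (card_pow_pos (F := F) (D - m)) ?_
    rw [h1, ← pow_add, Nat.add_sub_cancel' hm]
  have h2m : D ≤ 2 * (D - m) := by
    obtain ⟨a, ha, ha'⟩ := HE.half
    rwa [card_pow_injective (F := F) (hmA.symm.trans ha)]
  have hlt1 : q ^ m < q ^ (m + 1) := Nat.pow_lt_pow_right Fintype.one_lt_card (by omega)
  -- Rows start at `⌈D / 2⌉`, from where on `B` has no terms; `2 * ρ ≤ D` leaves room for `ρ` rows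
  -- below `D`.
  have hroot : (fun u => UB.eval (E u)) = 0 :=
    eq_zero_of_moore H.indepX _ ((D + 1) / 2) fun l hl => by
      rw [Fintype.card_fin] at hl
      rw [← H.coeff_comp HE.linUB (m := m + 1) (by rwa [hUB]) (by omega) (by omega),
        ← coeff_eq_of_dvd_sub HE.dvdB (by omega)]
      exact coeff_eq_zero_of_natDegree_lt (hB _ (by omega))
  have hroot' : ∀ u, UB.eval (E u) = 0 := congrFun hroot
  refine ⟨le_antisymm ?_ ?_, hUB, hroot'⟩
  -- If `ρ < m`, the rows above `D - m`, where `A` has no terms, already force `UA` to vanish on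
  -- `E`. Then the coefficient of `A` at `q ^ (D - m)` vanishes too, but it is the leading one.
  · by_contra! hlt
    have hUA : UA.natDegree < q ^ m := by
      by_cases h0 : UA = 0
      · rw [h0, natDegree_zero]
        exact card_pow_pos m
      · rw [← hUB]
        exact natDegree_lt_natDegree h0 HE.cofactor_degree_lt
    have hUA0 : (fun u => UA.eval (E u)) = 0 :=
      eq_zero_of_moore H.indepX _ (D - m + 1) fun l hl => by
        rw [Fintype.card_fin] at hl
        rw [← H.coeff_comp HE.linUA hUA (by omega) (by omega),
          ← coeff_eq_of_dvd_sub HE.dvdA (by omega)]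
        refine coeff_eq_zero_of_natDegree_lt ?_
        rw [hmA]
        exact Nat.pow_lt_pow_right Fintype.one_lt_card (by omega)
    have h1 : A.coeff (q ^ (D - m)) = 0 := by
      rw [coeff_eq_of_dvd_sub HE.dvdA (by omega),
        H.coeff_comp HE.linUA hUA (by omega) (by omega)]
      exact Finset.sum_eq_zero fun u _ => by rw [congrFun hUA0 u, Pi.zero_apply, zero_mul]
    rw [← hmA, coeff_natDegree, leadingCoeff_eq_zero] at h1
    rw [h1] at hmA
    exact (card_pow_pos (F := F) (D - m)).ne hmA
  · have h1 : Submodule.span F (Set.range E) ≤ rootSpace UB HE.linUB := by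
      rw [Submodule.span_le]
      rintro _ ⟨u, rfl⟩
      exact hroot' u
    have h2 := Submodule.finrank_mono h1
    rw [finrank_span_eq_card H.indepE, Fintype.card_fin] at h2
    exact h2.trans (finrank_rootSpace_le HE.linUB hUB)

/-- The recursion for `Δ` recovers the cofactor of the remainder. -/
theorem locatorPoly_eq (H : SyndromeDecomposition F D s E x) {B U : K[X]} (hU : IsLinearized q U)
    (hdeg : U.natDegree = q ^ ρ) (hroot : ∀ u, U.eval (E u) = 0)
    (hB : X ^ q ^ D ∣ B - U.comp (∑ j ∈ Finset.range D, C (s j) * X ^ q ^ j))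
    {j : ℕ} (hjD : j < D) (hj : s j ≠ 0) (hj_min : ∀ i < j, s i = 0) :
    locatorPoly q s B ρ j = U := by
  have h2ρ := H.two_mul_le
  have hlt1 : U.natDegree < q ^ (ρ + 1) := by
    rw [hdeg]
    exact Nat.pow_lt_pow_right Fintype.one_lt_card (by omega)
  have hρ : 0 < ρ := by
    refine Nat.pos_of_ne_zero ?_
    rintro rfl
    exact hj (by simpa using H.synd_eq j hjD)
  -- This keeps every index `j + p` with `p ≤ ρ` below `2 * ρ ≤ D`, where syndromes and congruence
  -- are available.
  have hjρ : j < ρ := by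
    obtain ⟨i, hi, hi0⟩ := H.exists_ne_zero hρ
    by_contra hle
    exact hi0 (hj_min i (by omega))
  rw [locatorPoly, hU.eq_sum hlt1]
  refine Finset.sum_congr rfl fun p hp => ?_
  congr 2
  rw [Finset.mem_range] at hp
  induction p using Nat.strong_induction_on with
  | _ p ih =>
    -- From index `ρ` on, the coefficients of the composition vanish because `U` vanishes on `E`;
    -- this justifies the zeros put in place of the coefficients of `B`.
    have hf : (if j + p < ρ then B.coeff (q ^ (j + p)) else 0) =
        (U.comp (∑ j ∈ Finset.range D, C (s j) * X ^ q ^ j)).coeff (q ^ (j + p)) := by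
      split_ifs with hlt
      · exact coeff_eq_of_dvd_sub hB (by omega)
      · rw [H.coeff_comp hU hlt1 (by omega) (by omega)]
        exact (Finset.sum_eq_zero fun u _ => by rw [hroot u, zero_mul]).symm
    have hsum : (U.comp (∑ j ∈ Finset.range D, C (s j) * X ^ q ^ j)).coeff (q ^ (j + p)) =
        ∑ i ∈ Finset.range (p + 1), U.coeff (q ^ i) * s (j + p - i) ^ q ^ i := by
      rw [coeff_comp_linearized hU hlt1 s D _ (by omega)]
      symm
      -- Terms with `i > p` involve a syndrome of index below `j`, which is zero; the system for the
      -- coefficients of `U` is thus triangular.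
      refine Finset.sum_subset_zero_on_sdiff (Finset.range_subset_range.2 (by omega)) ?_ ?_
      · intro i hi
        simp only [Finset.mem_sdiff, Finset.mem_range, not_lt] at hi
        split_ifs with h
        · rw [hj_min _ (by omega), zero_pow (card_pow_pos i).ne', mul_zero]
        · rfl
      · intro i hi
        rw [Finset.mem_range] at hi
        rw [if_pos (by omega)]
    rw [locatorCoeff, hf, hsum, Finset.sum_range_succ, Nat.add_sub_cancel, Finset.sum_range]
    rw [Finset.sum_congr rfl fun (i : Fin p) _ => by rw [← ih i i.2 (by omega)],
      add_sub_cancel_left, mul_div_cancel_right₀ _ (pow_ne_zero _ hj)]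

end Euclid

/-! ### Elimination of the erased coordinates. -/

section Elimination

variable {F : Type*} [Field F] [Fintype F] {K : Type*} [Field K] {n : ℕ}

local notation "q" => Fintype.card F

theorem getD_map_range {α : Type*} (f : ℕ → α) (L j : ℕ) (z : α) (hj : j < L) :
    ((List.range L).map f).getD j z = f j := by
  simp [hj]

theorem erasedSet_receivedWord (x e : Fin n → K) (T : Finset (Fin n)) :
    erasedSet (receivedWord x e T) = T := by
  ext i
  by_cases h : i ∈ T <;> simp [erasedSet, receivedWord, h]

variable [Algebra F K]

/-- The shape of a system from which all erased coordinates except those in `U` have been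
eliminated: `a` lists the coefficients of equation number `0`. -/
structure IsEliminated (F : Type*) {K : Type*} [Field F] [Fintype F] [Field K] [Algebra F K]
    {n : ℕ} (d : ℕ) (x w : Fin n → K) (T U : Finset (Fin n)) (θ : List (Equation K n))
    (a : Fin n → K) : Prop where
  subset : U ⊆ T
  length_add : θ.length + T.card = d - 1 + U.card
  coef : ∀ j < θ.length, ∀ i, coefAt θ j i = a i ^ Fintype.card F ^ j
  synd_eq : ∀ j < θ.length, synd θ j = ∑ i, a i ^ Fintype.card F ^ j * w i
  check : ∀ j < θ.length, ∑ i, a i ^ Fintype.card F ^ j * x i = 0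
  eq_zero : ∀ i ∈ T, i ∉ U → a i = 0
  indep : LinearIndepOn F a {i | i ∈ T → i ∈ U}

variable {d : ℕ} {x w a : Fin n → K} {T U : Finset (Fin n)} {θ : List (Equation K n)}

theorem isEliminated_initialSystem {h : Fin n → K} (hh : LinearIndependent F h)
    (hx : (mooreMatrix q h d).mulVec x = 0) (y : Fin n → Option K) :
    IsEliminated F d x (fun i => (y i).getD 0) T T (initialSystem q h d y) h where
  subset := subset_rfl
  length_add := by simp [initialSystem]
  coef j hj i := by
    rw [coefAt, initialSystem, getD_map_range _ _ _ _ (by simpa [initialSystem] using hj)]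
  synd_eq j hj := by
    rw [synd, initialSystem, getD_map_range _ _ _ _ (by simpa [initialSystem] using hj)]
    simp only [mul_comm]
  check j hj := congrFun hx ⟨j, by simpa [initialSystem] using hj⟩
  eq_zero i h1 h2 := absurd h1 h2
  indep := hh.linearIndepOn _

theorem sum_elimMap_pow_mul (a v : Fin n → K) (b : K) (j : ℕ) :
    ∑ i, elimMap F b (a i) ^ q ^ j * v i =
      (b ^ q / b) ^ q ^ j * ∑ i, a i ^ q ^ j * v i - ∑ i, a i ^ q ^ (j + 1) * v i := by
  rw [Finset.mul_sum, ← Finset.sum_sub_distrib]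
  refine Finset.sum_congr rfl fun i _ => ?_
  rw [elimMap_apply, sub_pow_card_pow, mul_pow, ← pow_mul, ← pow_succ']
  ring

/-- While `U` is nonempty at least one equation is left, so equation `0` is genuine and its
coefficient at `l` belongs to an independent family. -/
theorem IsEliminated.pivot_ne_zero (H : IsEliminated F d x w T U θ a) (hT : T.card ≤ d - 1)
    {l : Fin n} (hl : l ∈ U) : coefAt θ 0 l ≠ 0 := by
  have hU : 0 < U.card := Finset.card_pos.2 ⟨l, hl⟩
  have := H.length_add
  rw [H.coef 0 (by omega), pow_zero, pow_one]
  exact H.indep.ne_zero fun _ => hl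

theorem IsEliminated.eliminate (H : IsEliminated F d x w T U θ a) (hT : T.card ≤ d - 1)
    {l : Fin n} (hl : l ∈ U) :
    IsEliminated F d x w T (U.erase l) (eliminate q l θ) (fun i => elimMap F (a l) (a i)) := by
  have hU : 0 < U.card := Finset.card_pos.2 ⟨l, hl⟩
  have hlen := H.length_add
  have hlen' : (RankDecoding.eliminate q l θ).length = θ.length - 1 := by
    simp [RankDecoding.eliminate]
  have hal : a l ≠ 0 := H.indep.ne_zero fun _ => hl
  -- The range of `j` is nonempty only if there are two equations, so equation `1` is genuine
  -- wherever its coefficient is used; with a single equation its default value `0` is harmless.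
  have hget : ∀ j < θ.length - 1, (RankDecoding.eliminate q l θ).getD j 0 =
      (a l ^ q / a l) ^ q ^ j • θ.getD j 0 - θ.getD (j + 1) 0 := by
    intro j hj
    rw [RankDecoding.eliminate, getD_map_range _ _ _ _ hj, H.coef 0 (by omega),
      H.coef 1 (by omega), pow_zero, pow_one, pow_one]
  refine ⟨(Finset.erase_subset _ _).trans H.subset, ?_, ?_, ?_, ?_, ?_, ?_⟩
  · rw [hlen', Finset.card_erase_of_mem hl]
    omega
  · intro j hj i
    rw [hlen'] at hj
    have h0 := H.coef j (by omega) i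
    have h1 := H.coef (j + 1) (by omega) i
    rw [coefAt] at h0 h1 ⊢
    rw [hget j hj, Prod.fst_sub, Prod.smul_fst, Pi.sub_apply, Pi.smul_apply, h0, h1,
      elimMap_apply, sub_pow_card_pow, mul_pow, ← pow_mul, ← pow_succ', smul_eq_mul]
  · intro j hj
    rw [hlen'] at hj
    have h0 := H.synd_eq j (by omega)
    have h1 := H.synd_eq (j + 1) (by omega)
    rw [synd] at h0 h1 ⊢
    rw [hget j hj, Prod.snd_sub, Prod.smul_snd, h0, h1, sum_elimMap_pow_mul, smul_eq_mul]
  · intro j hj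
    rw [hlen'] at hj
    rw [sum_elimMap_pow_mul, H.check j (by omega), H.check (j + 1) (by omega), mul_zero, sub_zero]
  · intro i hiT hi
    by_cases hil : i = l
    · rw [hil, elimMap_self hal]
    · rw [H.eq_zero i hiT fun hiU => hi (Finset.mem_erase.2 ⟨hil, hiU⟩), map_zero]
  · refine LinearIndepOn.elimMap (fun h' => ?_) (H.indep.mono ?_)
    · exact Finset.notMem_erase l U (h' (H.subset hl))
    · rintro i (rfl | hi) hiT
      · exact hl
      · exact Finset.mem_of_mem_erase (hi hiT)

variable {e : Fin n → K}

/-- Subtracting the check satisfied by `x` leaves `e` off `T`; on `T` the coefficients are zero, so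
the default value at an erasure does not matter. -/
theorem IsEliminated.synd_eq_error (y : Fin n → Option K) (hy : y = receivedWord x e T)
    (heT : ∀ i ∈ T, e i = 0) (H : IsEliminated F d x (fun i => (y i).getD 0) T ∅ θ a)
    {j : ℕ} (hj : j < θ.length) : synd θ j = ∑ i, a i ^ q ^ j * e i := by
  rw [H.synd_eq j hj, ← sub_zero (∑ i, _ * (y i).getD 0), ← H.check j hj,
    ← Finset.sum_sub_distrib]
  refine Finset.sum_congr rfl fun i _ => ?_
  subst hy
  by_cases hi : i ∈ T
  · rw [H.eq_zero i hi (by simp), heT i hi, zero_pow (card_pow_pos j).ne']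
    ring
  · simp only [receivedWord, hi, if_false, Option.getD_some]
    ring

end Elimination

/-! ### Factoring the error through a basis of its span. -/

section Decomposition

variable {F : Type*} [Field F] {K : Type*} [Field K] [Algebra F K] {n ρ : ℕ}

/-- The entries of `E` are combinations of those of `e`, so `Y` has full row rank. Its rows are
supported off `T`, where `a` is independent, and hence map to independent elements. -/
theorem exists_decomposition {E : Fin ρ → K} (hE : LinearIndependent F E) {e a : Fin n → K}
    (hspan : Submodule.span F (Set.range E) = Submodule.span F (Set.range e))
    {T : Finset (Fin n)} (heT : ∀ i ∈ T, e i = 0) (ha : LinearIndepOn F a (Tᶜ : Finset (Fin n))) :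
    ∃ Y : Matrix (Fin ρ) (Fin n) F, (∀ p, ∀ i ∈ T, Y p i = 0) ∧ (∀ i, e i = ∑ p, Y p i • E p) ∧
      LinearIndependent F fun p => ∑ i, Y p i • a i := by
  have h1 : ∀ i, ∃ c : Fin ρ → F, ∑ p, c p • E p = e i := fun i => by
    rw [← Submodule.mem_span_range_iff_exists_fun, hspan]
    exact Submodule.subset_span ⟨i, rfl⟩
  choose Y hY using h1
  have hYT : ∀ p, ∀ i ∈ T, Y i p = 0 := fun p i hi =>
    Fintype.linearIndependent_iff.1 hE (Y i) ((hY i).trans (heT i hi)) p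
  refine ⟨fun p i => Y i p, hYT, fun i => (hY i).symm, ?_⟩
  rw [Fintype.linearIndependent_iff]
  intro c hc p₀
  have hcY : ∀ i, ∑ p, c p * Y i p = 0 := by
    intro i
    by_cases hi : i ∈ T
    · exact Finset.sum_eq_zero fun p _ => by rw [hYT p i hi, mul_zero]
    · refine linearIndepOn_finset_iff.1 ha (fun i => ∑ p, c p * Y i p) ?_ i (by simpa using hi)
      rw [← hc]
      simp only [Finset.smul_sum, Finset.sum_smul, smul_smul]
      rw [Finset.sum_comm]
      refine Finset.sum_congr rfl fun p _ => ?_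
      refine Finset.sum_subset (Finset.subset_univ _) fun i _ hi => ?_
      rw [hYT p i (by simpa using hi), mul_zero, zero_smul]
  -- Expressing `E p₀` through the coordinates of `e` gives a vector `g` that `Y` sends to the unit
  -- vector at `p₀`; pairing it with the relation `hcY` isolates `c p₀`.
  obtain ⟨g, hg⟩ := (Submodule.mem_span_range_iff_exists_fun F).1
    (hspan ▸ Submodule.subset_span ⟨p₀, rfl⟩ : E p₀ ∈ Submodule.span F (Set.range e))
  have hδ : ∀ p, ∑ i, g i * Y i p - (if p = p₀ then 1 else 0) = 0 := by
    refine Fintype.linearIndependent_iff.1 hE _ ?_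
    simp only [sub_smul, Finset.sum_sub_distrib, ite_smul, one_smul, zero_smul,
      Finset.sum_ite_eq', Finset.mem_univ, if_true]
    rw [sub_eq_zero]
    conv_rhs => rw [← hg]
    simp only [Finset.sum_smul, ← hY, Finset.smul_sum, smul_smul]
    exact Finset.sum_comm
  calc c p₀ = ∑ p, c p * ∑ i, g i * Y i p := by
        simp [fun p => sub_eq_zero.1 (hδ p)]
    _ = ∑ i, g i * ∑ p, c p * Y i p := by
        simp only [Finset.mul_sum]
        rw [Finset.sum_comm]
        exact Finset.sum_congr rfl fun i _ => Finset.sum_congr rfl fun p _ => by ring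
    _ = 0 := by simp [hcY]

theorem rankWt_zero : rankWt F (0 : Fin n → K) = 0 := by
  rw [rankWt, Set.finrank, Submodule.span_eq_bot.2 (by rintro _ ⟨i, rfl⟩; rfl), finrank_bot]

theorem eq_of_sum_smul_eq {a : Fin n → K} {T : Finset (Fin n)}
    (ha : LinearIndepOn F a (Tᶜ : Finset (Fin n))) {c c' : Fin n → F} (hc : ∀ i ∈ T, c i = 0)
    (hc' : ∀ i ∈ T, c' i = 0) (h : ∑ i, c i • a i = ∑ i, c' i • a i) : c = c' := by
  have h1 : ∑ i ∈ Tᶜ, (c i - c' i) • a i = 0 := by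
    rw [Finset.sum_subset (Finset.subset_univ _) fun i _ hi => by
      rw [Finset.mem_compl, not_not] at hi
      rw [hc i hi, hc' i hi, sub_self, zero_smul]]
    simp only [sub_smul, Finset.sum_sub_distrib, h, sub_self]
  funext i
  by_cases hi : i ∈ T
  · rw [hc i hi, hc' i hi]
  · exact sub_eq_zero.1 (linearIndepOn_finset_iff.1 ha _ h1 i (by simpa using hi))

theorem exists_basis_of_submodule (V : Submodule F K) [Module.Finite F V] :
    ∃ E : Fin (Module.finrank F V) → K,
      LinearIndependent F E ∧ Submodule.span F (Set.range E) = V := by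
  let b := Module.finBasis F V
  refine ⟨V.subtype ∘ b, b.linearIndependent.map' V.subtype V.ker_subtype, ?_⟩
  rw [Set.range_comp, ← Submodule.map_span, b.span_eq, Submodule.map_top, Submodule.range_subtype]

theorem exists_rankWt_basis (e : Fin n → K) : ∃ E : Fin (rankWt F e) → K,
    LinearIndependent F E ∧ Submodule.span F (Set.range E) = Submodule.span F (Set.range e) :=
  have := Module.Finite.span_of_finite F (Set.finite_range e)
  exists_basis_of_submodule (Submodule.span F (Set.range e))

theorem eq_zero_of_rankWt_eq_zero {e : Fin n → K} (h : rankWt F e = 0) : e = 0 := by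
  obtain ⟨E, -, hE⟩ := exists_rankWt_basis (F := F) e
  have : IsEmpty (Fin (rankWt F e)) := by rw [h]; infer_instance
  rw [Set.range_eq_empty, Submodule.span_empty, eq_comm, Submodule.span_eq_bot] at hE
  exact funext fun i => hE _ ⟨i, rfl⟩

variable [Fintype F]

local notation "q" => Fintype.card F

theorem syndromeDecomposition_of_sum {D : ℕ} (h2 : 2 * ρ ≤ D) {s : ℕ → K} {E : Fin ρ → K}
    (hE : LinearIndependent F E) {e a : Fin n → K} (hs : ∀ j < D, s j = ∑ i, a i ^ q ^ j * e i)
    {Y : Matrix (Fin ρ) (Fin n) F} (hY : ∀ i, e i = ∑ p, Y p i • E p)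
    (hYa : LinearIndependent F fun p => ∑ i, Y p i • a i) :
    SyndromeDecomposition F D s E fun p => ∑ i, Y p i • a i where
  two_mul_le := h2
  indepE := hE
  indepX := hYa
  synd_eq j hj := by
    simp only [hs j hj, sum_pow_card_pow, smul_pow_card_pow, Finset.mul_sum, hY]
    rw [Finset.sum_comm]
    refine Finset.sum_congr rfl fun p _ => Finset.sum_congr rfl fun i _ => ?_
    rw [mul_smul_comm, mul_smul_comm, mul_comm]

/-- The truncated syndrome system has at most one solution. -/
theorem eq_of_sum_mul_pow_eq {E x x' : Fin ρ → K} (hE : LinearIndependent F E)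
    (h : ∀ p < ρ, ∑ i, E i * x i ^ q ^ p = ∑ i, E i * x' i ^ q ^ p) : x = x' := by
  -- Raising equation `ρ - 1 - l` to the power `q ^ l` makes the exponent of the differences
  -- constant and moves the Frobenius powers to `E`: a Moore system in `E`.
  have h0 : (fun i => (x i - x' i) ^ q ^ (ρ - 1)) = 0 := by
    refine eq_zero_of_moore hE _ 0 fun l hl => ?_
    rw [Fintype.card_fin] at hl
    have h1 : (∑ i, E i * (x i - x' i) ^ q ^ (ρ - 1 - l)) ^ q ^ l = 0 := by
      rw [show ∑ i, E i * (x i - x' i) ^ q ^ (ρ - 1 - l) = 0 by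
        simp only [sub_pow_card_pow, mul_sub, Finset.sum_sub_distrib]
        rw [h _ (by omega), sub_self], zero_pow (card_pow_pos l).ne']
    rw [sum_pow_card_pow] at h1
    rw [← h1]
    refine Finset.sum_congr rfl fun i _ => ?_
    rw [mul_pow, ← pow_mul, ← pow_add, zero_add, mul_comm, Nat.sub_add_cancel (by omega)]
  funext i
  exact sub_eq_zero.1 (eq_zero_of_pow_eq_zero (congrFun h0 i))

end Decomposition

/-! ### The invariant of the decoder, progress and termination. -/

section Decoder

variable {F : Type*} [Field F] [Fintype F] {K : Type*} [Field K] {n : ℕ}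

local notation "q" => Fintype.card F

theorem euclidPair_start (θ : List (Equation K n)) :
    EuclidPair q θ.length (syndPoly q θ) (X ^ q ^ θ.length) (syndPoly q θ) 0 X := by
  refine .start (.sum _ _ fun _ _ => .monomial _ _) ?_
  refine (degree_sum_le _ _).trans_lt ((Finset.sup_lt_iff (WithBot.bot_lt_coe _)).2 ?_)
  intro j hj
  refine (degree_C_mul_X_pow_le _ _).trans_lt ?_
  exact_mod_cast Nat.pow_lt_pow_right Fintype.one_lt_card (Finset.mem_range.1 hj)

theorem length_of_half_le {A : K[X]} (hA : IsLinearized q A) {D : ℕ}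
    (hD : (q : ℝ) ^ ((D : ℝ) / 2) ≤ A.natDegree) :
    ∃ b, A.natDegree = q ^ b ∧ D ≤ 2 * b := by
  have hA0 : A ≠ 0 := by
    rintro rfl
    rw [natDegree_zero, Nat.cast_zero] at hD
    exact hD.not_gt (Real.rpow_pos_of_pos (by exact_mod_cast Fintype.card_pos) _)
  obtain ⟨b, hb⟩ := hA.natDegree_eq hA0
  exact ⟨b, hb, (rpow_half_le_iff (F := F) D b).1 (hb ▸ hD)⟩

theorem natDegree_lt_of_lt_half {B : K[X]} {D : ℕ}
    (hD : (B.natDegree : ℝ) < (q : ℝ) ^ ((D : ℝ) / 2)) (l : ℕ) (hl : D ≤ 2 * l) :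
    B.natDegree < q ^ l := by
  exact_mod_cast hD.trans_le ((rpow_half_le_iff (F := F) D l).2 hl)

/-- The correct erased values solve the initial system. -/
theorem initialSystem_solution {p d : ℕ} {h x e : Fin n → K} {T : Finset (Fin n)}
    (hcheck : (mooreMatrix p h d).mulVec x = 0)
    {f : Fin n → K} (hf : ∀ i ∈ T, f i = x i) {eq : Equation K n}
    (heq : eq ∈ initialSystem p h d (receivedWord x e T)) :
    ∑ i ∈ T, eq.1 i * f i + eq.2 = ∑ i ∈ Tᶜ, eq.1 i * e i := by
  simp only [initialSystem, List.mem_map, List.mem_range] at heq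
  obtain ⟨j, hj, rfl⟩ := heq
  have hx : ∑ i, h i ^ p ^ j * x i = 0 := congrFun hcheck ⟨j, hj⟩
  rw [← Finset.sum_add_sum_compl T] at hx
  have h1 : ∑ i, (receivedWord x e T i).getD 0 * h i ^ p ^ j =
      ∑ i ∈ Tᶜ, h i ^ p ^ j * x i + ∑ i ∈ Tᶜ, h i ^ p ^ j * e i := by
    rw [← Finset.sum_add_distrib]
    symm
    refine (Finset.sum_congr rfl fun i hi => ?_).trans
      (Finset.sum_subset (Finset.subset_univ _) fun i _ hi => ?_)
    · rw [receivedWord, if_neg (by simpa using hi), Option.getD_some]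
      ring
    · rw [receivedWord, if_pos (by simpa using hi), Option.getD_none, zero_mul]
  dsimp only
  rw [h1, ← add_assoc, Finset.sum_congr rfl fun i hi => by rw [hf i hi], hx, zero_add]

variable [Algebra F K]

/-- The word `x` satisfies the parity checks, and the error `e` and the erased set `T` are within
the correction radius. -/
structure IsCorrectable (F : Type*) {K : Type*} [Field F] [Fintype F] [Field K] [Algebra F K]
    {n : ℕ} (h : Fin n → K) (d : ℕ) (x e : Fin n → K) (T : Finset (Fin n)) : Prop where
  indep : LinearIndependent F h
  check : (mooreMatrix (Fintype.card F) h d).mulVec x = 0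
  eq_zero : ∀ i ∈ T, e i = 0
  bound : 2 * rankWt F e + T.card < d

/-- A completely eliminated system of a received word. -/
abbrev IsReduced (F : Type*) {K : Type*} [Field F] [Fintype F] [Field K] [Algebra F K]
    {n : ℕ} (d : ℕ) (x e : Fin n → K) (T : Finset (Fin n)) (θ : List (Equation K n))
    (a : Fin n → K) : Prop :=
  IsEliminated F d x (fun i => (receivedWord x e T i).getD 0) T ∅ θ a

/-- The invariant of the decoder. -/
def Invariant (F : Type*) {K : Type*} [Field F] [Fintype F] [Field K] [Algebra F K]
    {n : ℕ} (d : ℕ) (x e : Fin n → K) (T : Finset (Fin n)) : State K n → Prop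
  | .eliminating θ U =>
    ∃ a, IsEliminated F d x (fun i => (receivedWord x e T i).getD 0) T U θ a
  | .dividing θ A B =>
    ∃ a, IsReduced F d x e T θ a ∧ (∃ j < θ.length, synd θ j ≠ 0) ∧
      ∃ UA UB, EuclidPair (Fintype.card F) θ.length (syndPoly (Fintype.card F) θ) A B UA UB
  | .locating θ m Δ =>
    ∃ a, IsReduced F d x e T θ a ∧ (∃ j < θ.length, synd θ j ≠ 0) ∧ m = rankWt F e ∧
      IsLinearized (Fintype.card F) Δ ∧ Δ.natDegree = Fintype.card F ^ m ∧ ∀ i, Δ.eval (e i) = 0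
  | .rooted θ m E =>
    ∃ a, IsReduced F d x e T θ a ∧ (∃ j < θ.length, synd θ j ≠ 0) ∧ m = rankWt F e ∧
      LinearIndependent F E ∧ Submodule.span F (Set.range E) = Submodule.span F (Set.range e)
  | .solved θ m E x' =>
    ∃ a, IsReduced F d x e T θ a ∧ (∃ j < θ.length, synd θ j ≠ 0) ∧ m = rankWt F e ∧
      ∃ Y : Matrix (Fin m) (Fin n) F, (∀ p, ∀ i ∈ T, Y p i = 0) ∧ (∀ i, e i = ∑ p, Y p i • E p) ∧
        ∀ p, x' p = ∑ i, Y p i • a i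
  | .errorFound m e' => m = rankWt F e ∧ e' = e
  | .finished m e' f x' => m = rankWt F e ∧ e' = e ∧ (∀ i ∈ T, f i = x i) ∧ x' = x

variable {h : Fin n → K} {d : ℕ} {x e : Fin n → K} {T : Finset (Fin n)}
  {θ : List (Equation K n)} {a : Fin n → K}

theorem invariant_start (H : IsCorrectable F h d x e T) :
    Invariant F d x e T (start q h d (receivedWord x e T)) := by
  rw [start, erasedSet_receivedWord]
  exact ⟨h, isEliminated_initialSystem H.indep H.check _⟩

theorem IsReduced.synd_eq_error (H : IsCorrectable F h d x e T) (Hθ : IsReduced F d x e T θ a) :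
    ∀ j < θ.length, synd θ j = ∑ i, a i ^ q ^ j * e i :=
  fun _ hj => IsEliminated.synd_eq_error _ rfl H.eq_zero Hθ hj

theorem IsReduced.indep_compl (Hθ : IsReduced F d x e T θ a) :
    LinearIndepOn F a (Tᶜ : Finset (Fin n)) :=
  Hθ.indep.mono fun i hi hiT => absurd hiT (by simpa using hi)

theorem IsReduced.two_mul_rankWt_le (H : IsCorrectable F h d x e T)
    (Hθ : IsReduced F d x e T θ a) : 2 * rankWt F e ≤ θ.length := by
  have h1 := H.bound
  have h2 := Hθ.length_add
  rw [Finset.card_empty] at h2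
  omega

theorem IsReduced.exists_decomposition (H : IsCorrectable F h d x e T)
    (Hθ : IsReduced F d x e T θ a) {E : Fin (rankWt F e) → K} (hE : LinearIndependent F E)
    (hspan : Submodule.span F (Set.range E) = Submodule.span F (Set.range e)) :
    ∃ Y : Matrix (Fin (rankWt F e)) (Fin n) F, (∀ p, ∀ i ∈ T, Y p i = 0) ∧
      (∀ i, e i = ∑ p, Y p i • E p) ∧
      SyndromeDecomposition F θ.length (synd θ) E fun p => ∑ i, Y p i • a i := by
  obtain ⟨Y, h1, h2, h3⟩ := RankDecoding.exists_decomposition hE hspan H.eq_zero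
    (IsReduced.indep_compl Hθ)
  exact ⟨Y, h1, h2, syndromeDecomposition_of_sum (IsReduced.two_mul_rankWt_le H Hθ) hE
    (IsReduced.synd_eq_error H Hθ) h2 h3⟩

theorem eq_zero_of_synd_eq_zero (H : IsCorrectable F h d x e T) (Hθ : IsReduced F d x e T θ a)
    (hs : ∀ j < θ.length, synd θ j = 0) : e = 0 := by
  obtain ⟨E, hE, hspan⟩ := exists_rankWt_basis (F := F) e
  obtain ⟨Y, -, -, hD⟩ := IsReduced.exists_decomposition H Hθ hE hspan
  refine eq_zero_of_rankWt_eq_zero (F := F) (Nat.eq_zero_of_not_pos fun hpos => ?_)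
  obtain ⟨j, hj, hj0⟩ := hD.exists_ne_zero hpos
  have := hD.two_mul_le
  exact hj0 (hs j (by omega))

theorem invariant_halt [Finite K] (H : IsCorrectable F h d x e T)
    {A B : K[X]} {m j : ℕ} (hinv : Invariant F d x e T (.dividing θ A B))
    (hB : (B.natDegree : ℝ) < (q : ℝ) ^ ((θ.length : ℝ) / 2))
    (hm : m ≤ θ.length) (hmA : A.natDegree = q ^ (θ.length - m))
    (hj : synd θ j ≠ 0) (hj_min : ∀ i < j, synd θ i = 0) :
    Invariant F d x e T (.locating θ m (locatorPoly q (synd θ) B m j)) := by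
  obtain ⟨a, Hθ, hne, UA, UB, HE⟩ := hinv
  obtain ⟨E, hE, hspan⟩ := exists_rankWt_basis (F := F) e
  obtain ⟨Y, -, hY, hD⟩ := IsReduced.exists_decomposition H Hθ hE hspan
  obtain ⟨rfl, hdeg, hroot⟩ := HE.halt hD (natDegree_lt_of_lt_half hB) hm hmA
  have hjD : j < θ.length := by
    obtain ⟨i, hi, hi0⟩ := hne
    by_contra hle
    exact hi0 (hj_min i (by omega))
  rw [locatorPoly_eq hD HE.linUB hdeg hroot HE.dvdB hjD hj hj_min]
  refine ⟨a, Hθ, hne, rfl, HE.linUB, hdeg, fun i => ?_⟩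
  rw [← mem_rootSpace (hP := HE.linUB), hY i]
  exact Submodule.sum_mem _ fun p _ => Submodule.smul_mem _ _ (hroot p)

/-- The root space has dimension at most `m` and contains both the span of `E` and that of `e`, each
of dimension `m`; all three coincide. -/
theorem invariant_roots [Finite K] {m : ℕ} {Δ : K[X]} {E : Fin m → K}
    (hinv : Invariant F d x e T (.locating θ m Δ)) (hE : LinearIndependent F E)
    (hroot : ∀ p, Δ.IsRoot (E p)) : Invariant F d x e T (.rooted θ m E) := by
  obtain ⟨a, Hθ, hne, rfl, hlin, hdeg, he⟩ := hinv
  refine ⟨a, Hθ, hne, rfl, hE, ?_⟩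
  have hle := finrank_rootSpace_le hlin hdeg
  have h1 : Submodule.span F (Set.range E) ≤ rootSpace Δ hlin := by
    rw [Submodule.span_le]
    rintro _ ⟨p, rfl⟩
    exact hroot p
  have h2 : Submodule.span F (Set.range e) ≤ rootSpace Δ hlin := by
    rw [Submodule.span_le]
    rintro _ ⟨i, rfl⟩
    exact he i
  rw [Submodule.eq_of_le_of_finrank_le h1
      (by rw [finrank_span_eq_card hE, Fintype.card_fin]; exact hle),
    Submodule.eq_of_le_of_finrank_le h2 hle]

/-- The decomposition of `e` along the chosen basis `E` supplies one solution of the truncated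
system, and there is no other. -/
theorem invariant_solve (H : IsCorrectable F h d x e T) {m : ℕ} {E x' : Fin m → K}
    (hinv : Invariant F d x e T (.rooted θ m E))
    (hx' : ∀ p < m, synd θ p = ∑ i, E i * x' i ^ q ^ p) :
    Invariant F d x e T (.solved θ m E x') := by
  obtain ⟨a, Hθ, hne, rfl, hE, hspan⟩ := hinv
  obtain ⟨Y, hYT, hY, hD⟩ := IsReduced.exists_decomposition H Hθ hE hspan
  refine ⟨a, Hθ, hne, rfl, Y, hYT, hY, congrFun (eq_of_sum_mul_pow_eq hE fun p hp => ?_)⟩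
  have := hD.two_mul_le
  rw [← hx' p hp, hD.synd_eq p (by omega)]

theorem invariant_error {m : ℕ} {E x' : Fin m → K} {Y : Matrix (Fin m) (Fin n) F}
    (hinv : Invariant F d x e T (.solved θ m E x')) (hYT : ∀ p, ∀ i ∈ T, Y p i = 0)
    (hY : ∀ p, x' p = ∑ i, Y p i • coefAt θ 0 i) :
    Invariant F d x e T (.errorFound m fun i => ∑ p, Y p i • E p) := by
  obtain ⟨a, Hθ, ⟨j, hj, -⟩, rfl, Y', hYT', hY', hx'⟩ := hinv
  refine ⟨rfl, funext fun i => ?_⟩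
  rw [hY' i]
  refine Finset.sum_congr rfl fun p _ => ?_
  congr 1
  refine congrFun (eq_of_sum_smul_eq (IsReduced.indep_compl Hθ) (hYT p) (hYT' p) ?_) i
  rw [← hx' p, hY p]
  refine Finset.sum_congr rfl fun i _ => ?_
  rw [Hθ.coef 0 (by omega), pow_zero, pow_one]

theorem invariant_finish (H : IsCorrectable F h d x e T) {m : ℕ} {e' f : Fin n → K}
    (hinv : Invariant F d x e T (.errorFound m e'))
    (hf : ∀ eq ∈ initialSystem q h d (receivedWord x e T),
      ∑ i ∈ T, eq.1 i * f i + eq.2 = ∑ i ∈ Tᶜ, eq.1 i * e' i) :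
    Invariant F d x e T
      (.finished m e' f fun i => (receivedWord x e T i).getD (f i) - e' i) := by
  obtain ⟨rfl, rfl⟩ := hinv
  have hfx : ∀ i ∈ T, f i = x i := by
    intro i hi
    -- Both `f` and `x` solve the initial system, so their difference on `T` is in the kernel of a
    -- Moore matrix; `T.card < d` provides enough rows.
    refine sub_eq_zero.1 (eq_zero_of_moore_finset (F := F) T (H.indep.linearIndepOn _)
      (fun i => f i - x i) (fun l hl => ?_) i hi)
    have hbound := H.bound
    have hmem : ((fun i => h i ^ q ^ l), ∑ i, (receivedWord x e' T i).getD 0 * h i ^ q ^ l) ∈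
        initialSystem q h d (receivedWord x e' T) :=
      List.mem_map.2 ⟨l, List.mem_range.2 (by omega), rfl⟩
    have h1 := hf _ hmem
    rw [← initialSystem_solution H.check (f := x) (fun _ _ => rfl) hmem] at h1
    have h2 := add_right_cancel h1
    dsimp only at h2
    rw [← sub_eq_zero, ← Finset.sum_sub_distrib] at h2
    rw [← h2]
    exact Finset.sum_congr rfl fun i _ => by ring
  refine ⟨rfl, rfl, hfx, funext fun i => ?_⟩
  by_cases hi : i ∈ T
  · simp [receivedWord, hi, hfx i hi, H.eq_zero i hi]
  · simp [receivedWord, hi]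

theorem invariant_step [Finite K] (H : IsCorrectable F h d x e T) {σ τ : State K n}
    (hστ : Step F h d (receivedWord x e T) σ τ) (hσ : Invariant F d x e T σ) :
    Invariant F d x e T τ := by
  cases hστ with
  | elim θ U l hl pivot =>
    obtain ⟨a, Ha⟩ := hσ
    have := H.bound
    exact ⟨_, Ha.eliminate (by omega) hl⟩
  | noError θ hs =>
    obtain ⟨a, Ha⟩ := hσ
    have he := eq_zero_of_synd_eq_zero H Ha hs
    exact ⟨by rw [he, rankWt_zero], he.symm⟩
  | euclid θ hs =>
    obtain ⟨a, Ha⟩ := hσ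
    exact ⟨a, Ha, hs, 0, X, euclidPair_start θ⟩
  | divide θ A B Q R hcont hQ hR hdiv hdeg =>
    obtain ⟨a, Ha, hs, UA, UB, HE⟩ := hσ
    exact ⟨a, Ha, hs, _, _, HE.divide (length_of_half_le HE.linB hcont) hQ hR hdiv hdeg⟩
  | halt θ A B m j hA hB hm hmA hj hj_min => exact invariant_halt H hσ hB hm hmA hj hj_min
  | roots θ m Δ E hE hroot => exact invariant_roots hσ hE hroot
  | solve θ m E x' hx' => exact invariant_solve H hσ hx'
  | error θ m E x' Y hYT hY =>
    rw [erasedSet_receivedWord] at hYT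
    exact invariant_error hσ hYT hY
  | finish m e' f hf_supp hf =>
    rw [erasedSet_receivedWord] at hf
    exact invariant_finish H hσ hf

theorem invariant_of_reachable [Finite K] (H : IsCorrectable F h d x e T) {σ : State K n}
    (hσ : Reachable F h d (receivedWord x e T) σ) : Invariant F d x e T σ := by
  induction hσ with
  | refl => exact invariant_start H
  | tail _ hstep ih => exact invariant_step H hstep ih

theorem exists_step_of_dividing {A B : K[X]} (hinv : Invariant F d x e T (.dividing θ A B)) :
    ∃ τ, Step F h d (receivedWord x e T) (.dividing θ A B) τ := by
  classical
  obtain ⟨a, Ha, ⟨j, hj, hj0⟩, UA, UB, HE⟩ := hinv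
  by_cases hB : (q : ℝ) ^ ((θ.length : ℝ) / 2) ≤ B.natDegree
  · have hB0 : B ≠ 0 := by
      obtain ⟨b, hb, -⟩ := length_of_half_le HE.linB hB
      rintro rfl
      exact (card_pow_pos (F := F) b).ne hb
    obtain ⟨Q, R, hQ, hR, h1, h2⟩ := HE.linB.exists_right_division hB0 HE.linA
    exact ⟨_, .divide θ A B Q R hB hQ hR h1 h2⟩
  · have hex : ∃ j, synd θ j ≠ 0 := ⟨j, hj0⟩
    obtain ⟨b, hb, hb2⟩ := HE.half
    -- The degree of `A` is at most `q ^ D` by the conserved product; this makes `D - (D - b) = b`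
    -- correct for natural subtraction.
    have hbD : b ≤ θ.length := by
      rw [← Nat.pow_le_pow_iff_right (Fintype.one_lt_card (α := F)), ← hb, ← HE.natDegree_mul]
      refine Nat.le_mul_of_pos_left _ (HE.linUB.natDegree_pos ?_)
      rintro rfl
      simpa using HE.cofactor_degree_lt
    refine ⟨_, .halt θ A B (θ.length - b) (Nat.find hex) ?_ (not_le.1 hB) (by omega) ?_
      (Nat.find_spec hex) fun i hi => not_not.1 (Nat.find_min hex hi)⟩
    · rw [hb]
      exact (rpow_half_le_iff (F := F) _ b).2 hb2
    · rw [hb, Nat.sub_sub_self hbD]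

theorem finished_or_exists_step (H : IsCorrectable F h d x e T) {σ : State K n}
    (hσ : Invariant F d x e T σ) :
    (∃ m e' f x', σ = .finished m e' f x') ∨ ∃ τ, Step F h d (receivedWord x e T) σ τ := by
  cases σ with
  | eliminating θ U =>
    right
    obtain ⟨a, Ha⟩ := hσ
    have := H.bound
    obtain rfl | ⟨l, hl⟩ := U.eq_empty_or_nonempty
    · by_cases hs : ∀ j < θ.length, synd θ j = 0
      · exact ⟨_, .noError θ hs⟩
      · push Not at hs
        exact ⟨_, .euclid θ hs⟩
    · exact ⟨_, .elim θ U l hl (Ha.pivot_ne_zero (by omega) hl)⟩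
  | dividing θ A B => exact .inr (exists_step_of_dividing hσ)
  | locating θ m Δ =>
    right
    obtain ⟨a, Ha, hne, rfl, hlin, hdeg, he⟩ := hσ
    obtain ⟨E, hE, hspan⟩ := exists_rankWt_basis (F := F) e
    refine ⟨_, .roots θ _ Δ E hE fun p => ?_⟩
    have h1 : Submodule.span F (Set.range e) ≤ rootSpace Δ hlin := by
      rw [Submodule.span_le]
      rintro _ ⟨i, rfl⟩
      exact he i
    exact h1 (hspan ▸ Submodule.subset_span ⟨p, rfl⟩)
  | rooted θ m E =>
    right
    obtain ⟨a, Ha, hne, rfl, hE, hspan⟩ := hσ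
    obtain ⟨Y, -, -, hD⟩ := IsReduced.exists_decomposition H Ha hE hspan
    have := hD.two_mul_le
    exact ⟨_, .solve θ _ E _ fun p hp => hD.synd_eq p (by omega)⟩
  | solved θ m E x' =>
    right
    obtain ⟨a, Ha, ⟨j, hj, -⟩, rfl, Y, hYT, hY, hx'⟩ := hσ
    refine ⟨_, .error θ _ E x' Y (by rwa [erasedSet_receivedWord]) fun p => ?_⟩
    simp only [hx' p, Ha.coef 0 (by omega), pow_zero, pow_one]
  | errorFound m e' =>
    right
    obtain ⟨rfl, rfl⟩ := hσ
    refine ⟨_, .finish _ e' (fun i => if i ∈ T then x i else 0) ?_ ?_⟩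
    · rw [erasedSet_receivedWord]
      intro i hi
      rw [if_neg hi]
    · rw [erasedSet_receivedWord]
      exact fun eq heq => initialSystem_solution H.check (fun i hi => if_pos hi) heq
  | finished m e' f x' => exact .inl ⟨m, e', f, x', rfl⟩

/-- A measure that decreases along every step of the decoder. -/
def rankOfState : State K n → ℕ ×ₗ WithBot ℕ
  | .eliminating _ U => toLex (5, (U.card : WithBot ℕ))
  | .dividing _ _ B => toLex (4, B.degree)
  | .locating _ _ _ => toLex (3, ⊥)
  | .rooted _ _ _ => toLex (2, ⊥)
  | .solved _ _ _ _ => toLex (1, 0)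
  | .errorFound _ _ => toLex (1, ⊥)
  | .finished _ _ _ _ => toLex (0, ⊥)

/-- Only elimination and division stay within their phase: there the set of pending unknowns
shrinks, or the degree of the remainder drops, with `⊥` accounting for a zero remainder. -/
theorem rankOfState_lt {y : Fin n → Option K} {σ τ : State K n} (hστ : Step F h d y σ τ) :
    rankOfState τ < rankOfState σ := by
  cases hστ with
  | elim θ U l hl pivot =>
    simp only [rankOfState, Prod.Lex.toLex_lt_toLex]
    exact .inr ⟨trivial, by exact_mod_cast Finset.card_erase_lt_of_mem hl⟩
  | divide θ A B Q R hcont hQ hR hdiv hdeg =>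
    simp only [rankOfState, Prod.Lex.toLex_lt_toLex]
    exact .inr ⟨trivial, hdeg⟩
  | _ => simp [rankOfState, Prod.Lex.toLex_lt_toLex]

theorem not_exists_infinite_execution {y : Fin n → Option K} (σ : ℕ → State K n) :
    ¬ ∀ i, Step F h d y (σ i) (σ (i + 1)) := fun hσ =>
  (RelEmbedding.natGT (r := (· < ·)) (fun i => rankOfState (σ i))
    fun i => rankOfState_lt (hσ i)).not_wellFounded wellFounded_lt

end Decoder

end RankDecoding

end

/-! ### Correctness of the decoder. -/

theorem mainTheorem1 {F K : Type*} [Field F] [Fintype F] [Field K] [Finite K] [Algebra F K]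
    (n k d : ℕ) (h : Fin n → K) (hh : LinearIndependent F h)
    (Γ : Submodule K (Fin n → K)) (hΓ : RankDecoding.IsMRDCode F Γ k d)
    (hH : ∀ x : Fin n → K,
      x ∈ Γ ↔ (RankDecoding.mooreMatrix (Fintype.card F) h d).mulVec x = 0)
    (r s : ℕ) (hrs : 2 * r + s < d)
    (x : Fin n → K) (hx : x ∈ Γ)
    (T : Finset (Fin n)) (hT : T.card ≤ s)
    (e : Fin n → K) (heT : ∀ i ∈ T, e i = 0) (he : RankDecoding.rankWt F e ≤ r)
    (y : Fin n → Option K) (hy : y = RankDecoding.receivedWord x e T) :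
    -- every erased coordinate can be eliminated next: the pivot does not vanish
    (∀ θ U, RankDecoding.Reachable F h d y (.eliminating θ U) →
      ∀ l ∈ U, RankDecoding.coefAt θ 0 l ≠ 0) ∧
    -- once all erased coordinates are eliminated, only the errors remain in the reduced system
    (∀ θ, RankDecoding.Reachable F h d y (.eliminating θ ∅) →
      θ.length = d - 1 - T.card ∧
      ∀ j < θ.length, (∀ i ∈ T, RankDecoding.coefAt θ j i = 0) ∧
        (∀ i, RankDecoding.coefAt θ j i =
          RankDecoding.coefAt θ 0 i ^ Fintype.card F ^ j) ∧
        RankDecoding.synd θ j = ∑ i, RankDecoding.coefAt θ j i * e i) ∧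
    -- every execution terminates
    (¬ ∃ σ : ℕ → RankDecoding.State K n,
      σ 0 = RankDecoding.start (Fintype.card F) h d y ∧
      ∀ i, RankDecoding.Step F h d y (σ i) (σ (i + 1))) ∧
    -- no execution gets stuck before the final configuration
    (∀ σ, RankDecoding.Reachable F h d y σ →
      (∃ m e' f x', σ = .finished m e' f x') ∨ ∃ τ, RankDecoding.Step F h d y σ τ) ∧
    -- every final configuration carries the rank of the error, the error, the erased values
    -- and the transmitted codeword
    (∀ m e' f x', RankDecoding.Reachable F h d y (.finished m e' f x') →
      m = RankDecoding.rankWt F e ∧ e' = e ∧ (∀ i ∈ T, f i = x i) ∧ x' = x) := by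
  subst hy
  have H : RankDecoding.IsCorrectable F h d x e T := ⟨hh, (hH x).1 hx, heT, by omega⟩
  have hTd : T.card ≤ d - 1 := by omega
  refine ⟨fun θ U hR l hl => ?_, fun θ hR => ?_, fun ⟨σ, _, hσ⟩ => ?_, fun σ hR => ?_,
    fun m e' f x' hR => RankDecoding.invariant_of_reachable H hR⟩
  · obtain ⟨a, Ha⟩ := RankDecoding.invariant_of_reachable H hR
    exact Ha.pivot_ne_zero hTd hl
  · obtain ⟨a, Ha⟩ := RankDecoding.invariant_of_reachable H hR
    have hlen := Ha.length_add
    rw [Finset.card_empty] at hlen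
    refine ⟨by omega, fun j hj => ⟨fun i hi => ?_, fun i => ?_, ?_⟩⟩
    · rw [Ha.coef j hj, Ha.eq_zero i hi (by simp), zero_pow (RankDecoding.card_pow_pos j).ne']
    · rw [Ha.coef j hj, Ha.coef 0 (by omega), pow_zero, pow_one]
    · rw [RankDecoding.IsReduced.synd_eq_error H Ha j hj]
      exact Finset.sum_congr rfl fun i _ => by rw [Ha.coef j hj]
  · exact RankDecoding.not_exists_infinite_execution σ hσ
  · exact RankDecoding.finished_or_exists_step H (RankDecoding.invariant_of_reachable H hR)
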